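/- A triangulation $\mathcal T=(V,E,F)$ of the open disk is a locally finite abstract simplicial complex with vertex set $V$, edge set $E$ and set $F$ of (two-dimensional) faces whose geometric realization is homeomorphic to the open unit disk (equivalently, a triangulation of a simply connected surface with exactly one end); we call it an infinite disk triangulation ($V$ is infinite). Let $\Phi:E\to[0,\frac{\pi}{2}]$. A circle-packing metric is a function $r:V\to(0,\infty)$. It assigns to each edge $\{i,j\}$ the length $$l_{ij}=\sqrt{r_i^2+r_j^2+2\cos\Phi_{ij}\,r_ir_j}\quad\text{(Euclidean background)},$$ $$l_{ij}=\cosh^{-1}\left(\cosh r_i\cosh r_j+\cos\Phi_{ij}\sinh r_i\sinh r_j\right)\quad\text{(hyperbolic background)}.$$ For a face $\{i,j,k\}\in F$ let $\theta_i^{jk}$ be the inner angle at $i$ of the Euclidean (respectively hyperbolic) triangle with side lengths $l_{ij},l_{jk},l_{ik}$, and let $K_i=2\pi-\sum_{\{i,j,k\}\in F}\theta_i^{jk}$ be the discrete Gaussian curvature at $i$. The combinatorial Ricci flow (CRF) is $$\frac{dr_i}{dt}=-K_i\,r_i\ \ (i\in V)\quad\text{(Euclidean)},\qquad \frac{dr_i}{dt}=-K_i\sinh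 r_i\ \ (i\in V)\quad\text{(hyperbolic)}.$$ **Theorem.** Let $\mathcal T=(V,E,F)$ be an infinite disk triangulation whose vertex degrees are uniformly bounded, and let $\Phi\in[0,\frac{\pi}{2}]^E$. Then, in the Euclidean as well as in the hyperbolic background geometry, for every initial circle-packing metric $r(0)\in(0,\infty)^V$ there exists a solution $r(t)\in(0,\infty)^V$, $t\in[0,\infty)$, of the CRF with this initial value. It is $C^\infty$ in $t\in[0,\infty)$ at each vertex, and it is unique among all differentiable solutions on $[0,\infty)$ with values in $(0,\infty)^V$ (with one-sided derivative at $t=0$); no bound or growth condition on the solutions is assumed. -/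

import Mathlib

open Set
open scoped ContDiff

noncomputable section

namespace CRF

/-! ### Triangulations of the open disk -/

section Triangulation

variable {V : Type*}

/-- The geometric realization of an abstract simplicial complex, in barycentric coordinates:
points are the functions `x : V → ℝ` that are nonnegative, vanish off some simplex, and sum to `1`
on it. It carries the topology of the barycentric coordinates, which coincides with the
weak (CW) topology when the complex is locally finite. -/
def realization (T : AbstractSimplicialComplex V) : Set (V → ℝ) :=
  {x | ∃ s ∈ T.faces, (∀ v, 0 ≤ x v) ∧ (∀ v, v ∉ s → x v = 0) ∧ ∑ v ∈ s, x v = 1}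

/-- Every vertex lies in only finitely many simplices. -/
def IsLocallyFinite (T : AbstractSimplicialComplex V) : Prop :=
  ∀ v, {s ∈ T.faces | v ∈ s}.Finite

/-- A (locally finite) triangulation of the open unit disk. -/
structure IsDiskTriangulation (T : AbstractSimplicialComplex V) : Prop where
  locallyFinite : IsLocallyFinite T
  homeomorphic_disk : Nonempty (realization T ≃ₜ Metric.ball (0 : ℂ) 1)

open Classical in
/-- The `1`-skeleton: `i ∼ j` iff `{i, j}` is an edge of the triangulation. -/
def skeleton (T : AbstractSimplicialComplex V) : SimpleGraph V where
  Adj i j := i ≠ j ∧ ({i, j} : Finset V) ∈ T.faces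
  symm := ⟨fun i j h => ⟨h.1.symm, by rw [Finset.pair_comm]; exact h.2⟩⟩
  loopless := ⟨fun _ h => h.1 rfl⟩

/-- The combinatorial degree of a vertex. -/
def degree (T : AbstractSimplicialComplex V) (i : V) : ℕ∞ :=
  ((skeleton T).neighborSet i).encard

open Classical in
/-- The unordered pairs `{j, k}` such that `{i, j, k}` is a (two-dimensional) face; they correspond
bijectively to the faces containing `i`. -/
def oppositeEdges (T : AbstractSimplicialComplex V) (i : V) : Set (Sym2 V) :=
  {e | ∃ j k, e = s(j, k) ∧ i ≠ j ∧ i ≠ k ∧ j ≠ k ∧ ({i, j, k} : Finset V) ∈ T.faces}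

/-- In a locally finite complex a vertex lies in finitely many faces, so that the angle sum in
the curvature below is a genuine finite sum. -/
theorem oppositeEdges_finite {T : AbstractSimplicialComplex V} (hT : IsLocallyFinite T) (i : V) :
    (oppositeEdges T i).Finite := by
  classical
  refine ((hT i).biUnion (t := fun s => (s.sym2 : Set (Sym2 V)))
    fun s _ => s.sym2.finite_toSet).subset ?_
  rintro e ⟨j, k, rfl, -, -, -, h⟩
  refine Set.mem_biUnion (x := ({i, j, k} : Finset V)) ⟨h, by simp⟩ ?_
  simp

end Triangulation

/-! ### Circle-packing metrics -/

/-- The two background geometries. -/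
inductive Background
  | euclidean
  | hyperbolic

/-- The length of an edge whose end points carry circles of radii `a`, `b` that meet at
intersection angle `φ`. -/
def edgeLength (g : Background) (a b φ : ℝ) : ℝ :=
  match g with
  | .euclidean => √(a ^ 2 + b ^ 2 + 2 * Real.cos φ * a * b)
  | .hyperbolic =>
      Real.arcosh (Real.cosh a * Real.cosh b + Real.cos φ * Real.sinh a * Real.sinh b)

/-- The inner angle, between the sides of lengths `x` and `y`, of the geodesic triangle with side
lengths `x`, `y`, `z` (law of cosines). -/
def innerAngle (g : Background) (x y z : ℝ) : ℝ :=
  match g with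
  | .euclidean => Real.arccos ((x ^ 2 + y ^ 2 - z ^ 2) / (2 * x * y))
  | .hyperbolic =>
      Real.arccos ((Real.cosh x * Real.cosh y - Real.cosh z) / (Real.sinh x * Real.sinh y))

theorem edgeLength_comm (g : Background) (a b φ : ℝ) :
    edgeLength g a b φ = edgeLength g b a φ := by
  cases g <;> simp only [edgeLength] <;> congr 1 <;> ring

theorem innerAngle_comm (g : Background) (x y z : ℝ) :
    innerAngle g x y z = innerAngle g y x z := by
  cases g <;> simp only [innerAngle] <;> congr 1 <;> ring

section Flow

variable {V : Type*}

/-- The length of the edge `{i, j}` for the radii `r` and the intersection angles `Φ`. -/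
def length (g : Background) (Φ : Sym2 V → ℝ) (r : V → ℝ) (i j : V) : ℝ :=
  edgeLength g (r i) (r j) (Φ s(i, j))

/-- The inner angle `θ_i^{jk}` at `i` of the face `{i, j, k}`, as a function of the unordered
pair `{j, k}`. -/
def theta (g : Background) (Φ : Sym2 V → ℝ) (r : V → ℝ) (i : V) : Sym2 V → ℝ :=
  Sym2.lift ⟨fun j k => innerAngle g (length g Φ r i j) (length g Φ r i k) (length g Φ r j k),
    fun j k => by
      have h : length g Φ r j k = length g Φ r k j := by
        simp only [length]
        rw [edgeLength_comm, Sym2.eq_swap]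
      simp only [h, innerAngle_comm g (length g Φ r i j)]⟩

/-- The discrete Gaussian curvature `K_i = 2π - ∑ θ_i^{jk}`, the sum being over all faces
`{i, j, k}` that contain `i`. -/
def curvature (g : Background) (T : AbstractSimplicialComplex V) (Φ : Sym2 V → ℝ) (r : V → ℝ)
    (i : V) : ℝ :=
  2 * Real.pi - ∑ᶠ e ∈ oppositeEdges T i, theta g Φ r i e

/-- The right-hand side of the combinatorial Ricci flow: `-K_i r_i` in Euclidean and
`-K_i sinh r_i` in hyperbolic background geometry. -/
def flowField (g : Background) (T : AbstractSimplicialComplex V) (Φ : Sym2 V → ℝ) (r : V → ℝ)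
    (i : V) : ℝ :=
  match g with
  | .euclidean => -curvature g T Φ r i * r i
  | .hyperbolic => -curvature g T Φ r i * Real.sinh (r i)

/-- `r` is a global solution, on the time interval `[0, ∞)`, of the combinatorial Ricci flow with
initial value `r₀`; the derivative at `t = 0` is one-sided. -/
structure IsSolution (g : Background) (T : AbstractSimplicialComplex V) (Φ : Sym2 V → ℝ)
    (r₀ : V → ℝ) (r : ℝ → V → ℝ) : Prop where
  /-- At every time `r t` is a circle-packing metric. -/
  pos : ∀ t, 0 ≤ t → ∀ i, 0 < r t i
  initial : r 0 = r₀
  flow : ∀ t, 0 ≤ t → ∀ i,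
    HasDerivWithinAt (fun s => r s i) (flowField g T Φ (r t) i) (Ici 0) t

end Flow

end CRF

end

/-!
In the coordinates `u i` with `du = dr / sn r`, where `sn r` is `r` or `sinh r`, the flow reads
`u' = -K`. Each angle of a triangle of circles with intersection angles in `[0, π / 2]` is a
Lipschitz function of the coordinates of its three vertices, with a constant that depends on
nothing. Since the degrees are bounded, `-K` is therefore bounded and Lipschitz for the supremum
norm on `u`. Boundedness keeps any two solutions at finite sup distance, which gives uniqueness
without growth conditions, and Picard's theorem applies to the displacement `u - u(0)`, which lies
in `ℓ^∞(V)`. In the hyperbolic case `u` has to stay negative: angles at large circles are small, so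
that `K > 0` there, and the radii cannot grow beyond a barrier.
-/

noncomputable section

namespace CRF

open Filter Topology

/-! ### Ordinary differential equations in the supremum norm -/

section Ode

variable {V : Type*} {G : (V → ℝ) → V → ℝ} {Ω : Set (V → ℝ)} {C L : ℝ}

/-- `u` solves `u' = G(u)` on the time set `S`, coordinate by coordinate and with one-sided
derivatives at the end points of `S`. No topology on `V → ℝ` is involved. -/
def IsFlowLineOn (G : (V → ℝ) → V → ℝ) (u : ℝ → V → ℝ) (S : Set ℝ) : Prop :=
  ∀ t ∈ S, ∀ i, HasDerivWithinAt (fun s => u s i) (G (u t) i) S t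

/-- On `Ω` the field `G` is bounded by `C` and Lipschitz with constant `L` for the supremum norm.
The Lipschitz condition avoids that norm, since points of `V → ℝ` may be infinitely far apart. -/
structure IsUniformField (G : (V → ℝ) → V → ℝ) (Ω : Set (V → ℝ)) (C L : ℝ) : Prop where
  bound_nonneg : 0 ≤ C
  lipschitz_nonneg : 0 ≤ L
  bound : ∀ u ∈ Ω, ∀ i, |G u i| ≤ C
  lipschitz : ∀ u ∈ Ω, ∀ v ∈ Ω, ∀ δ, (∀ j, |u j - v j| ≤ δ) → ∀ i, |G u i - G v i| ≤ L * δ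

theorem IsUniformField.mono {Ω' : Set (V → ℝ)} (hG : IsUniformField G Ω C L) (h : Ω' ⊆ Ω) :
    IsUniformField G Ω' C L where
  bound_nonneg := hG.bound_nonneg
  lipschitz_nonneg := hG.lipschitz_nonneg
  bound u hu := hG.bound u (h hu)
  lipschitz u hu v hv := hG.lipschitz u (h hu) v (h hv)

theorem IsFlowLineOn.mono {u : ℝ → V → ℝ} {S S' : Set ℝ} (hu : IsFlowLineOn G u S)
    (h : S' ⊆ S) : IsFlowLineOn G u S' :=
  fun t ht i => (hu t (h ht) i).mono h

theorem IsFlowLineOn.continuousOn {u : ℝ → V → ℝ} {S : Set ℝ} (hu : IsFlowLineOn G u S) (i : V) :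
    ContinuousOn (fun s => u s i) S :=
  fun t ht => (hu t ht i).continuousWithinAt

theorem IsFlowLineOn.hasDerivWithinAt_sub {u v : ℝ → V → ℝ} {S : Set ℝ}
    (hu : IsFlowLineOn G u S) (hv : IsFlowLineOn G v S) {t : ℝ} (ht : t ∈ S) (i : V) :
    HasDerivWithinAt (fun s => u s i - v s i) (G (u t) i - G (v t) i) S t :=
  (hu t ht i).sub (hv t ht i)

theorem IsUniformField.abs_sub_le {u v : ℝ → V → ℝ} {T : ℝ} (hG : IsUniformField G Ω C L)
    (huΩ : MapsTo u (Icc 0 T) Ω) (hvΩ : MapsTo v (Icc 0 T) Ω)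
    (hu : IsFlowLineOn G u (Icc 0 T)) (hv : IsFlowLineOn G v (Icc 0 T)) (h0 : u 0 = v 0)
    {t : ℝ} (ht : t ∈ Icc 0 T) (i : V) : |u t i - v t i| ≤ 2 * C * t := by
  have h := norm_image_sub_le_of_norm_deriv_le_segment'
    (fun s hs => hu.hasDerivWithinAt_sub hv hs i) (C := 2 * C) (fun s hs => ?_) t ht
  · simpa [h0] using h
  · have hs' := Ico_subset_Icc_self hs
    calc |G (u s) i - G (v s) i| ≤ |G (u s) i| + |G (v s) i| := abs_sub _ _
      _ ≤ C + C := add_le_add (hG.bound _ (huΩ hs') i) (hG.bound _ (hvΩ hs') i)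
      _ = 2 * C := (two_mul C).symm

/-- The contraction step of Picard's argument for the Bielecki norm with weight `exp (-2 L t)`. -/
theorem IsUniformField.abs_sub_le_half_mul_exp {u v : ℝ → V → ℝ} {T D : ℝ}
    (hG : IsUniformField G Ω C L)
    (huΩ : MapsTo u (Icc 0 T) Ω) (hvΩ : MapsTo v (Icc 0 T) Ω)
    (hu : IsFlowLineOn G u (Icc 0 T)) (hv : IsFlowLineOn G v (Icc 0 T)) (h0 : u 0 = v 0)
    (hD : ∀ t ∈ Icc 0 T, ∀ i, |u t i - v t i| ≤ D * Real.exp (2 * L * t)) :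
    ∀ t ∈ Icc 0 T, ∀ i, |u t i - v t i| ≤ D / 2 * Real.exp (2 * L * t) := by
  intro t ht i
  have hD0 : 0 ≤ D := by simpa [h0] using hD 0 ⟨le_rfl, ht.1.trans ht.2⟩ i
  have hd := fun s (hs : s ∈ Icc 0 T) => hu.hasDerivWithinAt_sub hv hs i
  refine image_norm_le_of_norm_deriv_right_le_deriv_boundary
    (B := fun s => D / 2 * Real.exp (2 * L * s))
    (B' := fun s => L * (D * Real.exp (2 * L * s)))
    (fun s hs => (hd s hs).continuousWithinAt)
    (fun s hs => (hd s (Ico_subset_Icc_self hs)).mono_of_mem_nhdsWithin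
      (Icc_mem_nhdsGE_of_mem hs)) (by simpa [h0] using div_nonneg hD0 zero_le_two)
    (fun s => ?_)
    (fun s hs => ?_) ht
  · have h := (((hasDerivAt_id s).const_mul (2 * L)).exp).const_mul (D / 2)
    exact h.congr_deriv (by simp only [id_eq]; ring)
  · have hs' := Ico_subset_Icc_self hs
    exact hG.lipschitz _ (huΩ hs') _ (hvΩ hs') _ (hD s hs') i

theorem IsUniformField.eqOn_Icc {u v : ℝ → V → ℝ} {T : ℝ} (hG : IsUniformField G Ω C L)
    (huΩ : MapsTo u (Icc 0 T) Ω) (hvΩ : MapsTo v (Icc 0 T) Ω)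
    (hu : IsFlowLineOn G u (Icc 0 T)) (hv : IsFlowLineOn G v (Icc 0 T)) (h0 : u 0 = v 0) :
    EqOn u v (Icc 0 T) := by
  have hpow : ∀ n : ℕ, ∀ t ∈ Icc 0 T, ∀ i,
      |u t i - v t i| ≤ 2 * C * T * (1 / 2) ^ n * Real.exp (2 * L * t) := by
    intro n
    induction n with
    | zero =>
      intro t ht i
      have hexp : 1 ≤ Real.exp (2 * L * t) :=
        Real.one_le_exp (mul_nonneg (mul_nonneg zero_le_two hG.lipschitz_nonneg) ht.1)
      have hT : 0 ≤ 2 * C * T :=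
        mul_nonneg (mul_nonneg zero_le_two hG.bound_nonneg) (ht.1.trans ht.2)
      calc |u t i - v t i| ≤ 2 * C * t := hG.abs_sub_le huΩ hvΩ hu hv h0 ht i
        _ ≤ 2 * C * T :=
          mul_le_mul_of_nonneg_left ht.2 (mul_nonneg zero_le_two hG.bound_nonneg)
        _ ≤ 2 * C * T * (1 / 2) ^ 0 * Real.exp (2 * L * t) := by
          simpa using le_mul_of_one_le_right hT hexp
    | succ n ih =>
      intro t ht i
      refine (hG.abs_sub_le_half_mul_exp huΩ hvΩ hu hv h0 ih t ht i).trans_eq ?_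
      ring
  intro t ht
  funext i
  have hlim : Tendsto (fun n : ℕ => 2 * C * T * (1 / 2) ^ n * Real.exp (2 * L * t))
      atTop (𝓝 0) := by
    simpa using ((tendsto_pow_atTop_nhds_zero_of_lt_one (r := (1 / 2 : ℝ)) (by norm_num)
      (by norm_num)).const_mul (2 * C * T)).mul_const (Real.exp (2 * L * t))
  exact sub_eq_zero.1 (abs_nonpos_iff.1 (ge_of_tendsto' hlim fun n => hpow n t ht i))

/-- Picard–Lindelöf for the displacement `u - u₀`, which lives in the Banach space `ℓ^∞(V)`. -/
theorem IsUniformField.exists_isFlowLineOn_Icc (hG : IsUniformField G univ C L) (u₀ : V → ℝ)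
    {T : ℝ} (hT : 0 ≤ T) : ∃ u : ℝ → V → ℝ, u 0 = u₀ ∧ IsFlowLineOn G u (Icc 0 T) := by
  have hC := hG.bound_nonneg
  have hL := hG.lipschitz_nonneg
  let E := lp (fun _ : V => ℝ) ⊤
  let F : E → E := fun w => ⟨fun i => G (fun j => u₀ j + w j) i, memℓp_infty
    ⟨C, by rintro _ ⟨i, rfl⟩; exact hG.bound _ (mem_univ _) i⟩⟩
  have hF_bound : ∀ w, ‖F w‖ ≤ C := fun w =>
    lp.norm_le_of_forall_le hC fun i => hG.bound _ (mem_univ _) i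
  have hF_lipschitz : LipschitzWith ⟨L, hL⟩ F := by
    refine LipschitzWith.of_dist_le_mul fun w w' => ?_
    rw [dist_eq_norm, dist_eq_norm]
    refine lp.norm_le_of_forall_le (mul_nonneg hL (norm_nonneg _)) fun i => ?_
    refine hG.lipschitz _ (mem_univ _) _ (mem_univ _) _ (fun j => ?_) i
    simpa using lp.norm_apply_le_norm ENNReal.top_ne_zero (w - w') j
  have hpl : IsPicardLindelof (fun _ : ℝ => F) (tmin := 0) (tmax := T) ⟨0, le_rfl, hT⟩ (0 : E)
      ⟨C * T, mul_nonneg hC hT⟩ 0 ⟨C, hC⟩ ⟨L, hL⟩ := by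
    refine IsPicardLindelof.of_time_independent (fun w _ => hF_bound w)
      hF_lipschitz.lipschitzOnWith ?_
    simp only [sub_zero, sub_self, NNReal.coe_zero, max_eq_left hT]
    exact le_rfl
  obtain ⟨α, hα0, hα⟩ := hpl.exists_eq_forall_mem_Icc_hasDerivWithinAt₀
  refine ⟨fun t i => u₀ i + α t i, ?_, fun t ht i => ?_⟩
  · funext i
    simp [show α 0 = 0 from hα0]
  · have h := (lp.evalCLM ℝ (fun _ : V => ℝ) ⊤ i).hasFDerivAt.comp_hasDerivWithinAt t (hα t ht)
    exact h.const_add (u₀ i)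

theorem IsUniformField.exists_isFlowLineOn_Ici (hG : IsUniformField G univ C L) (u₀ : V → ℝ) :
    ∃ u : ℝ → V → ℝ, u 0 = u₀ ∧ IsFlowLineOn G u (Ici 0) := by
  choose w hw0 hw using fun n : ℕ =>
    hG.exists_isFlowLineOn_Icc u₀ (Nat.cast_nonneg (α := ℝ) n)
  have hagree : ∀ m n : ℕ, m ≤ n → EqOn (w m) (w n) (Icc 0 m) := fun m n hmn =>
    hG.eqOn_Icc (mapsTo_univ _ _) (mapsTo_univ _ _) (hw m)
      ((hw n).mono (Icc_subset_Icc_right (by exact_mod_cast hmn))) (by rw [hw0, hw0])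
  have hglue : ∀ n : ℕ, EqOn (fun t => w ⌈t⌉₊ t) (w n) (Icc 0 n) := fun n t ht =>
    hagree _ _ (Nat.ceil_le.2 ht.2) ⟨ht.1, Nat.le_ceil t⟩
  refine ⟨fun t => w ⌈t⌉₊ t, by simp [hw0], fun t (ht : 0 ≤ t) i => ?_⟩
  obtain ⟨n, hn⟩ := exists_nat_gt t
  have hmem : t ∈ Icc (0 : ℝ) n := ⟨ht, hn.le⟩
  have hnhds : Icc (0 : ℝ) n ∈ 𝓝[Ici 0] t := by
    rw [← Ici_inter_Iic]
    exact inter_mem_nhdsWithin _ (Iic_mem_nhds hn)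
  refine HasDerivWithinAt.mono_of_mem_nhdsWithin (t := Icc (0 : ℝ) n) ?_ hnhds
  rw [hglue n hmem]
  exact (hw n t hmem i).congr (fun s hs => congrFun (hglue n hs) i) (congrFun (hglue n hmem) i)

theorem IsUniformField.comp_min {m : V → ℝ} (hG : IsUniformField G {u | ∀ i, u i ≤ m i} C L) :
    IsUniformField (fun u => G fun j => min (u j) (m j)) univ C L where
  bound_nonneg := hG.bound_nonneg
  lipschitz_nonneg := hG.lipschitz_nonneg
  bound _ _ := hG.bound _ fun _ => min_le_right _ _
  lipschitz u _ v _ δ hδ := hG.lipschitz _ (fun _ => min_le_right _ _) _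
    (fun _ => min_le_right _ _) δ fun j => by
      refine (abs_min_sub_min_le_max (u j) (m j) (v j) (m j)).trans ?_
      simpa using hδ j

/-- Barrier argument: the flow of the field truncated at `m` cannot cross `m`, hence is a flow line
of the original field. -/
theorem IsUniformField.exists_isFlowLineOn_Ici_of_neg {m : V → ℝ}
    (hG : IsUniformField G {u | ∀ i, u i ≤ m i} C L)
    (hneg : ∀ u, (∀ i, u i ≤ m i) → ∀ i, u i = m i → G u i < 0) {u₀ : V → ℝ}
    (hu₀ : ∀ i, u₀ i ≤ m i) :
    ∃ u : ℝ → V → ℝ, u 0 = u₀ ∧ (∀ t ∈ Ici 0, ∀ i, u t i ≤ m i) ∧ IsFlowLineOn G u (Ici 0) := by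
  obtain ⟨u, hu0, hu⟩ := hG.comp_min.exists_isFlowLineOn_Ici u₀
  have hle : ∀ t ∈ Ici 0, ∀ i, u t i ≤ m i := by
    intro t ht i
    refine image_le_of_deriv_right_lt_deriv_boundary (B := fun _ => m i) (B' := fun _ => 0)
      ((hu.continuousOn i).mono Icc_subset_Ici_self)
      (fun s hs => (hu s hs.1 i).mono (Ici_subset_Ici.2 hs.1)) (by simpa [hu0] using hu₀ i)
      (fun s => hasDerivAt_const s (m i)) (fun s _ hs => ?_) (right_mem_Icc.2 ht)
    exact hneg _ (fun _ => min_le_right _ _) i (min_eq_right hs.ge)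
  refine ⟨u, hu0, hle, fun t ht i => (hu t ht i).congr_deriv ?_⟩
  simp only [min_eq_left (hle t ht _)]

end Ode

section ArccosDivSqrt

theorem div_sqrt_mem_Ioo {p q : ℝ} (h : p ^ 2 < q) : p / √q ∈ Ioo (-1) 1 := by
  have hq : 0 < √q := Real.sqrt_pos.2 ((sq_nonneg p).trans_lt h)
  have h' : |p| < √q := by
    rw [← Real.sqrt_sq_eq_abs]
    exact Real.sqrt_lt_sqrt (sq_nonneg p) h
  rw [mem_Ioo, lt_div_iff₀ hq, div_lt_iff₀ hq]
  constructor <;> linarith [(abs_lt.1 h').1, (abs_lt.1 h').2]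

theorem hasDerivWithinAt_arccos_div_sqrt {p q : ℝ → ℝ} {p' q' t : ℝ} {S : Set ℝ}
    (hp : HasDerivWithinAt p p' S t) (hq : HasDerivWithinAt q q' S t) (h : p t ^ 2 < q t) :
    HasDerivWithinAt (fun s => Real.arccos (p s / √(q s)))
      (-(p' - p t * q' / (2 * q t)) / √(q t - p t ^ 2)) S t := by
  have hq0 : 0 < q t := (sq_nonneg _).trans_lt h
  have hs : 0 < √(q t) := Real.sqrt_pos.2 hq0
  have hlt := div_sqrt_mem_Ioo h
  have h1 := (Real.hasDerivAt_arccos hlt.1.ne' hlt.2.ne).comp_hasDerivWithinAt t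
    (hp.div (hq.sqrt hq0.ne') hs.ne')
  refine h1.congr_deriv ?_
  have h2 : √(1 - (p t / √(q t)) ^ 2) = √(q t - p t ^ 2) / √(q t) := by
    rw [← Real.sqrt_div (by linarith), div_pow, Real.sq_sqrt hq0.le]
    congr 1
    field_simp
  have h3 : 0 < √(q t - p t ^ 2) := Real.sqrt_pos.2 (by linarith)
  rw [h2]
  have h4 : q t = √(q t) ^ 2 := (Real.sq_sqrt hq0.le).symm
  generalize √(q t - p t ^ 2) = d at *
  generalize √(q t) = r at *
  rw [h4]
  field_simp

theorem contDiffOn_arccos_div_sqrt {p q : ℝ → ℝ} {S : Set ℝ} {n : WithTop ℕ∞}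
    (hp : ContDiffOn ℝ n p S) (hq : ContDiffOn ℝ n q S) (h : ∀ t ∈ S, p t ^ 2 < q t) :
    ContDiffOn ℝ n (fun s => Real.arccos (p s / √(q s))) S := by
  intro t ht
  have hq0 : 0 < q t := (sq_nonneg _).trans_lt (h t ht)
  have hlt := div_sqrt_mem_Ioo (h t ht)
  exact ContDiffAt.comp_contDiffWithinAt (g := Real.arccos) (f := fun s => p s / √(q s)) t
    (Real.contDiffAt_arccos hlt.1.ne' hlt.2.ne) ((hp t ht).div ((hq t ht).sqrt hq0.ne')
      (Real.sqrt_pos.2 hq0).ne')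

end ArccosDivSqrt

/-! ### Trigonometry of a triangle of circles -/

section Trigonometry

/-- Minus the curvature of the background plane; it lets one formula serve both geometries. -/
def kappa (g : Background) : ℝ :=
  match g with
  | .euclidean => 0
  | .hyperbolic => 1

/-- The generalized sine of the background plane; the flow reads `r_i' = - K_i * sn r_i`. -/
def sn (g : Background) (x : ℝ) : ℝ :=
  match g with
  | .euclidean => x
  | .hyperbolic => Real.sinh x

/-- The generalized cosine of the background plane. -/
def cn (g : Background) (x : ℝ) : ℝ :=
  match g with
  | .euclidean => 1
  | .hyperbolic => Real.cosh x

theorem kappa_nonneg (g : Background) : 0 ≤ kappa g := by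
  cases g
  exacts [le_rfl, zero_le_one]

theorem sn_pos (g : Background) {x : ℝ} (hx : 0 < x) : 0 < sn g x := by
  cases g
  exacts [hx, Real.sinh_pos_iff.2 hx]

theorem cn_pos (g : Background) (x : ℝ) : 0 < cn g x := by
  cases g
  exacts [one_pos, Real.cosh_pos x]

theorem cn_sq (g : Background) (x : ℝ) : cn g x ^ 2 = 1 + kappa g * sn g x ^ 2 := by
  cases g
  · simp [cn, kappa]
  · simp only [cn, kappa, sn, Real.cosh_sq]
    ring

theorem hasDerivAt_sn (g : Background) (x : ℝ) : HasDerivAt (sn g) (cn g x) x := by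
  cases g
  exacts [hasDerivAt_id x, Real.hasDerivAt_sinh x]

theorem hasDerivAt_cn (g : Background) (x : ℝ) : HasDerivAt (cn g) (kappa g * sn g x) x := by
  cases g
  · exact (hasDerivAt_const x (1 : ℝ)).congr_deriv (zero_mul _).symm
  · exact (Real.hasDerivAt_cosh x).congr_deriv (one_mul _).symm

theorem contDiff_sn (g : Background) {n : WithTop ℕ∞} : ContDiff ℝ n (sn g) := by
  cases g
  exacts [contDiff_id, Real.contDiff_sinh]

theorem contDiff_cn (g : Background) {n : WithTop ℕ∞} : ContDiff ℝ n (cn g) := by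
  cases g
  exacts [contDiff_const, Real.contDiff_cosh]

/-- The generalized cosine of the side joining the centers of circles of radii `x` and `y` whose
intersection angle has cosine `γ`. -/
def cosSide (g : Background) (γ x y : ℝ) : ℝ :=
  cn g x * cn g y + kappa g * γ * sn g x * sn g y

/-- The squared generalized sine of the side joining the centers of circles of radii `x` and `y`
whose intersection angle has cosine `γ`. -/
def sqSide (g : Background) (γ x y : ℝ) : ℝ :=
  sn g x ^ 2 + sn g y ^ 2 + 2 * γ * sn g x * sn g y * cn g x * cn g y +
    kappa g * (1 + γ ^ 2) * (sn g x * sn g y) ^ 2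

/-- The cosine of the angle at the center of the circle of radius `x`, times the generalized sines
of the two adjacent sides. Here `α`, `β`, `γ` are the cosines of the intersection angles of the
circles of radii `y, z`, of `x, z` and of `x, y`. -/
def angleNum (g : Background) (α β γ x y z : ℝ) : ℝ :=
  sn g x ^ 2 * cn g y * cn g z +
    sn g x * cn g x * (γ * sn g y * cn g z + β * sn g z * cn g y) +
    kappa g * β * γ * sn g x ^ 2 * sn g y * sn g z - α * sn g y * sn g z

/-- The square of the product of the generalized sines of two sides and the sine of their angle. It
does not depend on the angle chosen. -/
def gram (g : Background) (α β γ x y z : ℝ) : ℝ :=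
  (sn g x * sn g y) ^ 2 * (1 - γ ^ 2) + (sn g x * sn g z) ^ 2 * (1 - β ^ 2) +
    (sn g y * sn g z) ^ 2 * (1 - α ^ 2) +
    2 * kappa g * (sn g x * sn g y * sn g z) ^ 2 * (1 + α * β * γ) +
    2 * (sn g x * sn g y * sn g z) *
      (sn g z * cn g x * cn g y * (γ + α * β) + sn g y * cn g x * cn g z * (β + α * γ) +
        sn g x * cn g y * cn g z * (α + β * γ))

/-- The positive factor in the derivative of the angle at the circle of radius `x` with respect to
`y`, see `hasDerivWithinAt_faceAngle`. -/
def weight (g : Background) (α β γ x y z : ℝ) : ℝ :=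
  sn g x * sn g y * cn g z * (1 - γ ^ 2) +
    sn g z * (sn g x * cn g y * (α + β * γ) + sn g y * cn g x * (β + α * γ))

/-- The derivative of the side joining the centers of circles of radii `x` and `y` along
`x' = sn x`, times its generalized sine: `cosSide' = kappa * slope` and
`sqSide' = 2 * cosSide * slope`. -/
def slope (g : Background) (γ x y : ℝ) : ℝ :=
  sn g x * (sn g x * cn g y + γ * cn g x * sn g y)

/-- The angle at the center of the circle of radius `x` in the triangle of centers of circles of
radii `x`, `y`, `z`, whose pairwise intersection angles have cosines `α`, `β`, `γ` as in
`angleNum`. -/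
def faceAngle (g : Background) (α β γ x y z : ℝ) : ℝ :=
  Real.arccos (angleNum g α β γ x y z / √(sqSide g γ x y * sqSide g β x z))

variable (g : Background) (α β γ x y z : ℝ)

theorem gram_swap : gram g α γ β x z y = gram g α β γ x y z := by
  unfold gram; ring

theorem angleNum_swap : angleNum g α γ β x z y = angleNum g α β γ x y z := by
  unfold angleNum; ring

theorem cosSide_sq : cosSide g γ x y ^ 2 = 1 + kappa g * sqSide g γ x y := by
  unfold cosSide sqSide
  linear_combination cn_sq g y * (1 + kappa g * sn g x ^ 2) + cn_sq g x * cn g y ^ 2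

theorem kappa_mul_angleNum :
    kappa g * angleNum g α β γ x y z = cosSide g γ x y * cosSide g β x z - cosSide g α y z := by
  unfold cosSide angleNum
  linear_combination -cn g y * cn g z * cn_sq g x

theorem sqSide_mul_sqSide_sub_angleNum_sq :
    sqSide g γ x y * sqSide g β x z - angleNum g α β γ x y z ^ 2 = gram g α β γ x y z := by
  unfold sqSide angleNum gram
  grind [cn_sq]

theorem cosSide_mul_sqSide_sub :
    cosSide g β x z * sqSide g γ x y - cosSide g γ x y * angleNum g α β γ x y z =
      angleNum g β α γ y x z := by
  unfold sqSide angleNum cosSide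
  grind [cn_sq]

theorem slope_mul_sqSide_sub :
    slope g α y z * sqSide g γ x y - slope g γ y x * angleNum g β α γ y x z =
      sn g x * sn g y * weight g α β γ x y z := by
  unfold sqSide angleNum weight slope
  grind [cn_sq]

theorem slope_mul_angleNum :
    slope g γ x y * angleNum g β α γ y x z =
      sn g x * sn g y * weight g α β γ x y z * cosSide g γ x y -
        sn g x * (β * cn g y * sn g z - γ * sn g y * cn g z) * sqSide g γ x y := by
  unfold sqSide angleNum weight slope cosSide
  grind [cn_sq]

end Trigonometry

section Bounds

variable (g : Background) {α β γ x y z : ℝ}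

theorem one_le_cn (x : ℝ) : 1 ≤ cn g x := by
  rw [← one_le_sq_iff₀ (cn_pos g x).le, cn_sq]
  exact le_add_of_nonneg_right (mul_nonneg (kappa_nonneg g) (sq_nonneg _))

theorem cosSide_pos (hγ : 0 ≤ γ) (hx : 0 < x) (hy : 0 < y) : 0 < cosSide g γ x y := by
  have := kappa_nonneg g
  have := sn_pos g hx
  have := sn_pos g hy
  have := cn_pos g x
  have := cn_pos g y
  unfold cosSide
  positivity

theorem sn_sq_add_sn_sq_le_sqSide (hγ : 0 ≤ γ) (hx : 0 < x) (hy : 0 < y) :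
    sn g x ^ 2 + sn g y ^ 2 + kappa g * (sn g x * sn g y) ^ 2 ≤ sqSide g γ x y := by
  have := kappa_nonneg g
  have := sn_pos g hx
  have := sn_pos g hy
  have := cn_pos g x
  have := cn_pos g y
  have h : 0 ≤ 2 * γ * sn g x * sn g y * cn g x * cn g y +
    kappa g * γ ^ 2 * (sn g x * sn g y) ^ 2 := by positivity
  unfold sqSide
  linarith

theorem sqSide_pos (hγ : 0 ≤ γ) (hx : 0 < x) (hy : 0 < y) : 0 < sqSide g γ x y := by
  have := kappa_nonneg g
  have := sn_pos g hx
  have := sn_pos g hy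
  exact lt_of_lt_of_le (by positivity) (sn_sq_add_sn_sq_le_sqSide g hγ hx hy)

theorem one_add_cosSide_sq_le : (1 + cosSide g γ x y) ^ 2 ≤ 4 + 2 * kappa g * sqSide g γ x y := by
  linarith [cosSide_sq g γ x y, sq_nonneg (1 - cosSide g γ x y)]

theorem sn_mul_sn_mul_one_add_cosSide_le (hγ : γ ∈ Icc (0 : ℝ) 1) (hx : 0 < x) (hy : 0 < y) :
    sn g x * sn g y * (1 + cosSide g γ x y) ≤ 2 * sqSide g γ x y := by
  have hP := sn_sq_add_sn_sq_le_sqSide g hγ.1 hx hy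
  have hab := two_mul_le_add_sq (sn g x) (sn g y)
  have hAB := two_mul_le_add_sq (sn g x * cn g y) (sn g y * cn g x)
  have hγab : kappa g * γ * (sn g x * sn g y) ^ 2 ≤ kappa g * 1 * (sn g x * sn g y) ^ 2 := by
    have := kappa_nonneg g
    gcongr
    exact hγ.2
  rw [mul_pow, mul_pow, cn_sq, cn_sq] at hAB
  unfold cosSide
  linarith [sq_nonneg (sn g x), sq_nonneg (sn g y)]

theorem sn_mul_cn_add_le (hγ : 0 ≤ γ) (hx : 0 < x) (hy : 0 < y) :
    sn g x * cn g y + sn g y * cn g x ≤ 2 * √(sqSide g γ x y) := by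
  have h4 : (2 : ℝ) * √(sqSide g γ x y) = √(4 * sqSide g γ x y) := by
    rw [Real.sqrt_mul zero_le_four, show (4 : ℝ) = 2 ^ 2 by norm_num, Real.sqrt_sq zero_le_two]
  rw [h4]
  refine Real.le_sqrt_of_sq_le ?_
  have hP := sn_sq_add_sn_sq_le_sqSide g hγ hx hy
  have hAB := two_mul_le_add_sq (sn g x * cn g y) (sn g y * cn g x)
  have hsq : (sn g x * cn g y) ^ 2 + (sn g y * cn g x) ^ 2 =
      sn g x ^ 2 + sn g y ^ 2 + 2 * kappa g * (sn g x * sn g y) ^ 2 := by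
    grind [cn_sq]
  nlinarith [sq_nonneg (sn g x), sq_nonneg (sn g y)]

theorem sq_mul_one_sub_sq_add_le_gram (hα : α ∈ Icc (0 : ℝ) 1) (hβ : β ∈ Icc (0 : ℝ) 1)
    (hγ : 0 ≤ γ) (hx : 0 < x) (hy : 0 < y) (hz : 0 < z) :
    (sn g x * sn g y) ^ 2 * (1 - γ ^ 2) + kappa g * (sn g x * sn g y * sn g z) ^ 2 ≤
      gram g α β γ x y z := by
  obtain ⟨hα0, hα1⟩ := hα
  obtain ⟨hβ0, hβ1⟩ := hβ
  have := kappa_nonneg g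
  have := sn_pos g hx
  have := sn_pos g hy
  have := sn_pos g hz
  have := cn_pos g x
  have := cn_pos g y
  have := cn_pos g z
  have hα2 : 0 ≤ 1 - α ^ 2 := sub_nonneg.2 (pow_le_one₀ hα0 hα1)
  have hβ2 : 0 ≤ 1 - β ^ 2 := sub_nonneg.2 (pow_le_one₀ hβ0 hβ1)
  have h : 0 ≤ (sn g x * sn g z) ^ 2 * (1 - β ^ 2) + (sn g y * sn g z) ^ 2 * (1 - α ^ 2) +
      kappa g * (sn g x * sn g y * sn g z) ^ 2 * (1 + 2 * (α * β * γ)) +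
      2 * (sn g x * sn g y * sn g z) *
        (sn g z * cn g x * cn g y * (γ + α * β) + sn g y * cn g x * cn g z * (β + α * γ) +
          sn g x * cn g y * cn g z * (α + β * γ)) := by positivity
  unfold gram
  linarith

theorem sn_mul_sn_mul_cn_mul_one_sub_sq_le (hα : α ∈ Icc (0 : ℝ) 1) (hβ : β ∈ Icc (0 : ℝ) 1)
    (hγ : γ ∈ Icc (0 : ℝ) 1) (hx : 0 < x) (hy : 0 < y) (hz : 0 < z) :
    sn g x * sn g y * cn g z * (1 - γ ^ 2) ≤ √(gram g α β γ x y z) := by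
  refine Real.le_sqrt_of_sq_le (le_trans ?_
    (sq_mul_one_sub_sq_add_le_gram g hα hβ hγ.1 hx hy hz))
  have := kappa_nonneg g
  have hγ2 : 0 ≤ 1 - γ ^ 2 := sub_nonneg.2 (pow_le_one₀ hγ.1 hγ.2)
  have hγ2' : 1 - γ ^ 2 ≤ 1 := sub_le_self _ (sq_nonneg γ)
  calc (sn g x * sn g y * cn g z * (1 - γ ^ 2)) ^ 2
      = (sn g x * sn g y) ^ 2 * ((1 - γ ^ 2) * (1 - γ ^ 2)) +
          kappa g * (sn g x * sn g y * sn g z) ^ 2 * ((1 - γ ^ 2) * (1 - γ ^ 2)) := by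
        grind [cn_sq]
    _ ≤ (sn g x * sn g y) ^ 2 * ((1 - γ ^ 2) * 1) +
          kappa g * (sn g x * sn g y * sn g z) ^ 2 * (1 * 1) := by gcongr
    _ = _ := by ring

theorem sq_mul_sq_le {a b : ℝ} (hα : α ∈ Icc (0 : ℝ) 1) (hβ : β ∈ Icc (0 : ℝ) 1) (ha : 0 ≤ a)
    (hb : 0 ≤ b) : a ^ 2 * b ^ 2 ≤ (a ^ 2 + b ^ 2) * (a ^ 2 + b ^ 2 - (α * b - β * a) ^ 2) := by
  have hαb := mul_le_of_le_one_left hb hα.2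
  have hβa := mul_le_of_le_one_left ha hβ.2
  have hαb0 := mul_nonneg hα.1 hb
  have hβa0 := mul_nonneg hβ.1 ha
  rcases le_total (β * a) (α * b) with h | h
  · have : (α * b - β * a) ^ 2 ≤ b ^ 2 := pow_le_pow_left₀ (by linarith) (by linarith) 2
    nlinarith [sq_nonneg a, sq_nonneg b]
  · have : (β * a - α * b) ^ 2 ≤ a ^ 2 := pow_le_pow_left₀ (by linarith) (by linarith) 2
    nlinarith [sq_nonneg a, sq_nonneg b]

theorem sq_mul_le_gram (hα : 0 ≤ α) (hβ : 0 ≤ β) (hγ : γ ∈ Icc (0 : ℝ) 1)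
    (hx : 0 < x) (hy : 0 < y) (hz : 0 < z) :
    sn g z ^ 2 * (sn g x ^ 2 + sn g y ^ 2 - (α * sn g y - β * sn g x) ^ 2) ≤
      gram g α β γ x y z := by
  obtain ⟨hγ0, hγ1⟩ := hγ
  have := kappa_nonneg g
  have := sn_pos g hx
  have := sn_pos g hy
  have := sn_pos g hz
  have := cn_pos g x
  have := cn_pos g y
  have := cn_pos g z
  have hAB : 0 ≤ cn g x * cn g y - 1 :=
    sub_nonneg.2 (one_le_mul_of_one_le_of_one_le (one_le_cn g x) (one_le_cn g y))
  have hγ2 : 0 ≤ 1 - γ ^ 2 := sub_nonneg.2 (pow_le_one₀ hγ0 hγ1)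
  have h : 0 ≤ (sn g x * sn g y) ^ 2 * (1 - γ ^ 2) +
      2 * kappa g * (sn g x * sn g y * sn g z) ^ 2 * (1 + α * β * γ) +
      2 * (sn g x * sn g y * sn g z) *
        (sn g z * (cn g x * cn g y * γ + α * β * (cn g x * cn g y - 1)) +
          sn g y * cn g x * cn g z * (β + α * γ) + sn g x * cn g y * cn g z * (α + β * γ)) := by
    positivity
  unfold gram
  linarith

theorem sq_le_sqSide_mul_gram (hα : α ∈ Icc (0 : ℝ) 1) (hβ : β ∈ Icc (0 : ℝ) 1)
    (hγ : γ ∈ Icc (0 : ℝ) 1) (hx : 0 < x) (hy : 0 < y) (hz : 0 < z) :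
    (sn g x * sn g y * sn g z) ^ 2 ≤ sqSide g γ x y * gram g α β γ x y z := by
  have hab := sq_mul_sq_le hα hβ (sn_pos g hx).le (sn_pos g hy).le
  have hG := sq_mul_le_gram g hα.1 hβ.1 hγ hx hy hz
  have hP : sn g x ^ 2 + sn g y ^ 2 ≤ sqSide g γ x y := by
    have := mul_nonneg (kappa_nonneg g) (sq_nonneg (sn g x * sn g y))
    linarith [sn_sq_add_sn_sq_le_sqSide g hγ.1 hx hy]
  have hsum : 0 < sn g x ^ 2 + sn g y ^ 2 :=
    add_pos (pow_pos (sn_pos g hx) 2) (pow_pos (sn_pos g hy) 2)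
  have hdiff : 0 ≤ sn g x ^ 2 + sn g y ^ 2 - (α * sn g y - β * sn g x) ^ 2 :=
    nonneg_of_mul_nonneg_right ((by positivity : (0 : ℝ) ≤ _).trans hab) hsum
  calc (sn g x * sn g y * sn g z) ^ 2 = sn g z ^ 2 * (sn g x ^ 2 * sn g y ^ 2) := by ring
    _ ≤ sn g z ^ 2 * ((sn g x ^ 2 + sn g y ^ 2) *
          (sn g x ^ 2 + sn g y ^ 2 - (α * sn g y - β * sn g x) ^ 2)) := by gcongr
    _ = (sn g x ^ 2 + sn g y ^ 2) *
          (sn g z ^ 2 * (sn g x ^ 2 + sn g y ^ 2 - (α * sn g y - β * sn g x) ^ 2)) := by ring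
    _ ≤ sqSide g γ x y * gram g α β γ x y z :=
      mul_le_mul hP hG (mul_nonneg (sq_nonneg _) hdiff) (sqSide_pos g hγ.1 hx hy).le

theorem gram_pos (hα : α ∈ Icc (0 : ℝ) 1) (hβ : β ∈ Icc (0 : ℝ) 1)
    (hγ : γ ∈ Icc (0 : ℝ) 1) (hx : 0 < x) (hy : 0 < y) (hz : 0 < z) :
    0 < gram g α β γ x y z := by
  have := sn_pos g hx
  have := sn_pos g hy
  have := sn_pos g hz
  exact pos_of_mul_pos_right (lt_of_lt_of_le (by positivity)
    (sq_le_sqSide_mul_gram g hα hβ hγ hx hy hz)) (sqSide_pos g hγ.1 hx hy).le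

theorem sn_mul_sn_mul_sn_mul_one_add_cosSide_le (hα : α ∈ Icc (0 : ℝ) 1)
    (hβ : β ∈ Icc (0 : ℝ) 1) (hγ : γ ∈ Icc (0 : ℝ) 1) (hx : 0 < x) (hy : 0 < y) (hz : 0 < z) :
    sn g x * sn g y * sn g z * (1 + cosSide g γ x y) ≤
      3 * (√(sqSide g γ x y) * √(gram g α β γ x y z)) := by
  have hP := sqSide_pos g hγ.1 hx hy
  have hG := gram_pos g hα hβ hγ hx hy hz
  have hPG := sq_le_sqSide_mul_gram g hα hβ hγ hx hy hz
  have hκ : kappa g * (sn g x * sn g y * sn g z) ^ 2 ≤ gram g α β γ x y z := by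
    have := mul_nonneg (sq_nonneg (sn g x * sn g y)) (sub_nonneg.2 (pow_le_one₀ hγ.1 hγ.2 (n := 2)))
    linarith [sq_mul_one_sub_sq_add_le_gram g hα hβ hγ.1 hx hy hz]
  refine abs_le_of_sq_le_sq' ?_ (by positivity) |>.2
  calc (sn g x * sn g y * sn g z * (1 + cosSide g γ x y)) ^ 2
      = (sn g x * sn g y * sn g z) ^ 2 * (1 + cosSide g γ x y) ^ 2 := mul_pow _ _ 2
    _ ≤ (sn g x * sn g y * sn g z) ^ 2 * (4 + 2 * kappa g * sqSide g γ x y) := by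
      gcongr
      exact one_add_cosSide_sq_le g
    _ = 4 * (sn g x * sn g y * sn g z) ^ 2 +
          2 * sqSide g γ x y * (kappa g * (sn g x * sn g y * sn g z) ^ 2) := by ring
    _ ≤ 4 * (sqSide g γ x y * gram g α β γ x y z) +
          2 * sqSide g γ x y * gram g α β γ x y z := by gcongr
    _ ≤ 9 * (sqSide g γ x y * gram g α β γ x y z) := by linarith [mul_pos hP hG]
    _ = _ := by
      rw [mul_pow, mul_pow, Real.sq_sqrt hP.le, Real.sq_sqrt hG.le]
      norm_num

theorem weight_nonneg (hα : 0 ≤ α) (hβ : 0 ≤ β) (hγ : γ ∈ Icc (0 : ℝ) 1) (hx : 0 < x)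
    (hy : 0 < y) (hz : 0 < z) : 0 ≤ weight g α β γ x y z := by
  obtain ⟨hγ0, hγ1⟩ := hγ
  have := sn_pos g hx
  have := sn_pos g hy
  have := sn_pos g hz
  have := cn_pos g x
  have := cn_pos g y
  have := cn_pos g z
  have hγ2 : 0 ≤ 1 - γ ^ 2 := sub_nonneg.2 (pow_le_one₀ hγ0 hγ1)
  unfold weight
  positivity

theorem weight_le (hα : α ∈ Icc (0 : ℝ) 1) (hβ : β ∈ Icc (0 : ℝ) 1) (hγ : γ ∈ Icc (0 : ℝ) 1)
    (hx : 0 < x) (hy : 0 < y) (hz : 0 < z) :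
    weight g α β γ x y z ≤ √(gram g α β γ x y z) + 4 * sn g z * √(sqSide g γ x y) := by
  have ha := sn_pos g hx
  have hb := sn_pos g hy
  have hc := sn_pos g hz
  have hA := cn_pos g x
  have hB := cn_pos g y
  have hαβγ : α + β * γ ≤ 2 := by linarith [hα.2, mul_le_one₀ hβ.2 hγ.1 hγ.2]
  have hβαγ : β + α * γ ≤ 2 := by linarith [hβ.2, mul_le_one₀ hα.2 hγ.1 hγ.2]
  calc weight g α β γ x y z
      ≤ √(gram g α β γ x y z) + sn g z * (sn g x * cn g y * 2 + sn g y * cn g x * 2) := by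
        unfold weight
        gcongr
        exact sn_mul_sn_mul_cn_mul_one_sub_sq_le g hα hβ hγ hx hy hz
    _ = √(gram g α β γ x y z) + 2 * sn g z * (sn g x * cn g y + sn g y * cn g x) := by ring
    _ ≤ √(gram g α β γ x y z) + 2 * sn g z * (2 * √(sqSide g γ x y)) := by
        gcongr
        exact sn_mul_cn_add_le g hγ.1 hx hy
    _ = _ := by ring

theorem sn_mul_sn_mul_weight_mul_one_add_cosSide_le (hα : α ∈ Icc (0 : ℝ) 1)
    (hβ : β ∈ Icc (0 : ℝ) 1) (hγ : γ ∈ Icc (0 : ℝ) 1) (hx : 0 < x) (hy : 0 < y) (hz : 0 < z) :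
    sn g x * sn g y * weight g α β γ x y z * (1 + cosSide g γ x y) ≤
      14 * (sqSide g γ x y * √(gram g α β γ x y z)) := by
  have ha := sn_pos g hx
  have hb := sn_pos g hy
  have hX := cosSide_pos g hγ.1 hx hy
  calc sn g x * sn g y * weight g α β γ x y z * (1 + cosSide g γ x y)
      ≤ sn g x * sn g y * (√(gram g α β γ x y z) + 4 * sn g z * √(sqSide g γ x y)) *
          (1 + cosSide g γ x y) := by
        gcongr
        exact weight_le g hα hβ hγ hx hy hz
    _ = sn g x * sn g y * (1 + cosSide g γ x y) * √(gram g α β γ x y z) +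
          4 * √(sqSide g γ x y) * (sn g x * sn g y * sn g z * (1 + cosSide g γ x y)) := by ring
    _ ≤ 2 * sqSide g γ x y * √(gram g α β γ x y z) +
          4 * √(sqSide g γ x y) * (3 * (√(sqSide g γ x y) * √(gram g α β γ x y z))) := by
        gcongr ?_ * _ + _ * ?_
        · exact sn_mul_sn_mul_one_add_cosSide_le g hγ hx hy
        · exact sn_mul_sn_mul_sn_mul_one_add_cosSide_le g hα hβ hγ hx hy hz
    _ = 2 * sqSide g γ x y * √(gram g α β γ x y z) +
          12 * √(sqSide g γ x y) ^ 2 * √(gram g α β γ x y z) := by ring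
    _ = _ := by
        rw [Real.sq_sqrt (sqSide_pos g hγ.1 hx hy).le]
        ring

end Bounds

section Derivative

variable (g : Background) {α β γ : ℝ}

/-- The left-hand side is `(p * q' / 2 - q * p')`, where `p / √q` is the cosine of the angle: its
derivative splits into contributions of the two neighbors, each with a controllable weight. -/
theorem deriv_faceAngle_numerator_eq (x y z dx dy dz : ℝ) :
    sqSide g γ x y * sqSide g β x z *
          (slope g α y z * dy + slope g α z y * dz -
            cosSide g β x z * (slope g γ x y * dx + slope g γ y x * dy) -
            cosSide g γ x y * (slope g β x z * dx + slope g β z x * dz)) +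
        angleNum g α β γ x y z *
          (cosSide g γ x y * (slope g γ x y * dx + slope g γ y x * dy) * sqSide g β x z +
            sqSide g γ x y * (cosSide g β x z * (slope g β x z * dx + slope g β z x * dz))) =
      sn g x * sn g y * weight g α β γ x y z * (dy - cosSide g γ x y * dx) * sqSide g β x z +
        sn g x * sn g z * weight g α γ β x z y * (dz - cosSide g β x z * dx) * sqSide g γ x y := by
  have hy := cosSide_mul_sqSide_sub g α β γ x y z
  have hz := cosSide_mul_sqSide_sub g α γ β x z y
  rw [angleNum_swap] at hz
  linear_combination
    (-(slope g γ x y * dx + slope g γ y x * dy) * sqSide g β x z) * hy -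
      (slope g β x z * dx + slope g β z x * dz) * sqSide g γ x y * hz +
      dy * sqSide g β x z * slope_mul_sqSide_sub g α β γ x y z +
      dz * sqSide g γ x y * slope_mul_sqSide_sub g α γ β x z y -
      dx * sqSide g β x z * slope_mul_angleNum g α β γ x y z -
      dx * sqSide g γ x y * slope_mul_angleNum g α γ β x z y

variable {x y z : ℝ → ℝ} {t dx dy dz : ℝ} {S : Set ℝ}

theorem hasDerivWithinAt_sqSide (hx : HasDerivWithinAt x (sn g (x t) * dx) S t)
    (hy : HasDerivWithinAt y (sn g (y t) * dy) S t) :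
    HasDerivWithinAt (fun s => sqSide g γ (x s) (y s))
      (2 * cosSide g γ (x t) (y t) *
        (slope g γ (x t) (y t) * dx + slope g γ (y t) (x t) * dy)) S t := by
  have ha := (hasDerivAt_sn g _).comp_hasDerivWithinAt t hx
  have hb := (hasDerivAt_sn g _).comp_hasDerivWithinAt t hy
  have hA := (hasDerivAt_cn g _).comp_hasDerivWithinAt t hx
  have hB := (hasDerivAt_cn g _).comp_hasDerivWithinAt t hy
  have h := (((ha.pow 2).add (hb.pow 2)).add ((((ha.const_mul (2 * γ)).mul hb).mul hA).mul hB)).add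
    (((ha.mul hb).pow 2).const_mul (kappa g * (1 + γ ^ 2)))
  refine h.congr_deriv ?_
  simp only [Pi.mul_apply, Function.comp_apply, cosSide, slope]
  grind [cn_sq]

theorem hasDerivWithinAt_angleNum (hx : HasDerivWithinAt x (sn g (x t) * dx) S t)
    (hy : HasDerivWithinAt y (sn g (y t) * dy) S t)
    (hz : HasDerivWithinAt z (sn g (z t) * dz) S t) :
    HasDerivWithinAt (fun s => angleNum g α β γ (x s) (y s) (z s))
      (cosSide g β (x t) (z t) * (slope g γ (x t) (y t) * dx + slope g γ (y t) (x t) * dy) +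
        cosSide g γ (x t) (y t) * (slope g β (x t) (z t) * dx + slope g β (z t) (x t) * dz) -
        (slope g α (y t) (z t) * dy + slope g α (z t) (y t) * dz)) S t := by
  have ha := (hasDerivAt_sn g _).comp_hasDerivWithinAt t hx
  have hb := (hasDerivAt_sn g _).comp_hasDerivWithinAt t hy
  have hc := (hasDerivAt_sn g _).comp_hasDerivWithinAt t hz
  have hA := (hasDerivAt_cn g _).comp_hasDerivWithinAt t hx
  have hB := (hasDerivAt_cn g _).comp_hasDerivWithinAt t hy
  have hC := (hasDerivAt_cn g _).comp_hasDerivWithinAt t hz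
  have h := (((((ha.pow 2).mul hB).mul hC).add
      ((ha.mul hA).mul (((hb.const_mul γ).mul hC).add ((hc.const_mul β).mul hB)))).add
      ((((ha.pow 2).const_mul (kappa g * β * γ)).mul hb).mul hc)).sub
      ((hb.const_mul α).mul hc)
  refine h.congr_deriv ?_
  simp only [Pi.mul_apply, Pi.add_apply, Pi.pow_apply, Function.comp_apply, cosSide, slope]
  grind [cn_sq]

theorem hasDerivWithinAt_faceAngle (hα : α ∈ Icc (0 : ℝ) 1) (hβ : β ∈ Icc (0 : ℝ) 1)
    (hγ : γ ∈ Icc (0 : ℝ) 1) (hx0 : 0 < x t) (hy0 : 0 < y t) (hz0 : 0 < z t)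
    (hx : HasDerivWithinAt x (sn g (x t) * dx) S t)
    (hy : HasDerivWithinAt y (sn g (y t) * dy) S t)
    (hz : HasDerivWithinAt z (sn g (z t) * dz) S t) :
    HasDerivWithinAt (fun s => faceAngle g α β γ (x s) (y s) (z s))
      (sn g (x t) * sn g (y t) * weight g α β γ (x t) (y t) (z t) /
          (sqSide g γ (x t) (y t) * √(gram g α β γ (x t) (y t) (z t))) *
          (dy - cosSide g γ (x t) (y t) * dx) +
        sn g (x t) * sn g (z t) * weight g α γ β (x t) (z t) (y t) /
          (sqSide g β (x t) (z t) * √(gram g α β γ (x t) (y t) (z t))) *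
          (dz - cosSide g β (x t) (z t) * dx)) S t := by
  have hG := gram_pos g hα hβ hγ hx0 hy0 hz0
  have hPQ := sqSide_mul_sqSide_sub_angleNum_sq g α β γ (x t) (y t) (z t)
  have h := hasDerivWithinAt_arccos_div_sqrt (hasDerivWithinAt_angleNum g hx hy hz)
    ((hasDerivWithinAt_sqSide g hx hy).mul (hasDerivWithinAt_sqSide g hx hz))
    (sub_pos.1 (hPQ ▸ hG))
  refine h.congr_deriv ?_
  have hs : √(gram g α β γ (x t) (y t) (z t)) ≠ 0 := (Real.sqrt_pos.2 hG).ne'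
  have hP := (sqSide_pos g hγ.1 hx0 hy0).ne'
  have hQ := (sqSide_pos g hβ.1 hx0 hz0).ne'
  simp only [Pi.mul_apply, hPQ]
  field_simp
  linear_combination
    deriv_faceAngle_numerator_eq g (α := α) (β := β) (γ := γ) (x t) (y t) (z t) dx dy dz

theorem abs_weight_div_mul_le {x y z dx dy δ : ℝ} (hα : α ∈ Icc (0 : ℝ) 1)
    (hβ : β ∈ Icc (0 : ℝ) 1) (hγ : γ ∈ Icc (0 : ℝ) 1) (hx : 0 < x) (hy : 0 < y) (hz : 0 < z)
    (hdx : |dx| ≤ δ) (hdy : |dy| ≤ δ) :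
    |sn g x * sn g y * weight g α β γ x y z / (sqSide g γ x y * √(gram g α β γ x y z)) *
        (dy - cosSide g γ x y * dx)| ≤ 14 * δ := by
  have hδ : 0 ≤ δ := (abs_nonneg _).trans hdx
  have hX := cosSide_pos g hγ.1 hx hy
  have hW := weight_nonneg g hα.1 hβ.1 hγ hx hy hz
  have hab := mul_pos (sn_pos g hx) (sn_pos g hy)
  have hPs : 0 < sqSide g γ x y * √(gram g α β γ x y z) :=
    mul_pos (sqSide_pos g hγ.1 hx hy) (Real.sqrt_pos.2 (gram_pos g hα hβ hγ hx hy hz))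
  have hd : |dy - cosSide g γ x y * dx| ≤ (1 + cosSide g γ x y) * δ :=
    calc |dy - cosSide g γ x y * dx| ≤ |dy| + |cosSide g γ x y * dx| := abs_sub _ _
      _ ≤ δ + cosSide g γ x y * δ := by
        rw [abs_mul, abs_of_pos hX]
        gcongr
      _ = (1 + cosSide g γ x y) * δ := by ring
  rw [abs_mul, abs_of_nonneg (div_nonneg (mul_nonneg hab.le hW) hPs.le)]
  calc _ ≤ sn g x * sn g y * weight g α β γ x y z / (sqSide g γ x y * √(gram g α β γ x y z)) *
        ((1 + cosSide g γ x y) * δ) := by gcongr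
    _ = sn g x * sn g y * weight g α β γ x y z * (1 + cosSide g γ x y) /
        (sqSide g γ x y * √(gram g α β γ x y z)) * δ := by ring
    _ ≤ 14 * δ := by
      gcongr
      exact (div_le_iff₀ hPs).2
        (sn_mul_sn_mul_weight_mul_one_add_cosSide_le g hα hβ hγ hx hy hz)

theorem exists_hasDerivWithinAt_faceAngle {δ : ℝ} (hα : α ∈ Icc (0 : ℝ) 1)
    (hβ : β ∈ Icc (0 : ℝ) 1) (hγ : γ ∈ Icc (0 : ℝ) 1)
    (hx0 : 0 < x t) (hy0 : 0 < y t) (hz0 : 0 < z t)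
    (hdx : |dx| ≤ δ) (hdy : |dy| ≤ δ) (hdz : |dz| ≤ δ)
    (hx : HasDerivWithinAt x (sn g (x t) * dx) S t)
    (hy : HasDerivWithinAt y (sn g (y t) * dy) S t)
    (hz : HasDerivWithinAt z (sn g (z t) * dz) S t) :
    ∃ d, |d| ≤ 28 * δ ∧
      HasDerivWithinAt (fun s => faceAngle g α β γ (x s) (y s) (z s)) d S t := by
  refine ⟨_, ?_, hasDerivWithinAt_faceAngle g hα hβ hγ hx0 hy0 hz0 hx hy hz⟩
  have hxy := abs_weight_div_mul_le g hα hβ hγ hx0 hy0 hz0 hdx hdy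
  have hxz := abs_weight_div_mul_le g hα hγ hβ hx0 hz0 hy0 hdx hdz
  rw [gram_swap] at hxz
  exact (abs_add_le _ _).trans (by linarith)

theorem contDiffOn_faceAngle (hα : α ∈ Icc (0 : ℝ) 1) (hβ : β ∈ Icc (0 : ℝ) 1)
    (hγ : γ ∈ Icc (0 : ℝ) 1) (hx0 : ∀ s ∈ S, 0 < x s) (hy0 : ∀ s ∈ S, 0 < y s)
    (hz0 : ∀ s ∈ S, 0 < z s) {n : WithTop ℕ∞} (hx : ContDiffOn ℝ n x S)
    (hy : ContDiffOn ℝ n y S) (hz : ContDiffOn ℝ n z S) :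
    ContDiffOn ℝ n (fun s => faceAngle g α β γ (x s) (y s) (z s)) S := by
  have ha := (contDiff_sn g).comp_contDiffOn hx
  have hb := (contDiff_sn g).comp_contDiffOn hy
  have hc := (contDiff_sn g).comp_contDiffOn hz
  have hA := (contDiff_cn g).comp_contDiffOn hx
  have hB := (contDiff_cn g).comp_contDiffOn hy
  have hC := (contDiff_cn g).comp_contDiffOn hz
  simp only [Function.comp_def] at ha hb hc hA hB hC
  refine contDiffOn_arccos_div_sqrt ?_ ?_ fun s hs => ?_
  · unfold angleNum
    fun_prop
  · unfold sqSide
    fun_prop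
  · rw [← sub_pos, sqSide_mul_sqSide_sub_angleNum_sq]
    exact gram_pos g hα hβ hγ (hx0 s hs) (hy0 s hs) (hz0 s hs)

end Derivative

section Side

variable {x y z φ χ ψ : ℝ}

theorem one_le_cosSide (g : Background) {γ : ℝ} (hγ : 0 ≤ γ) (hx : 0 < x) (hy : 0 < y) :
    1 ≤ cosSide g γ x y := by
  have := kappa_nonneg g
  have := sn_pos g hx
  have := sn_pos g hy
  exact le_add_of_le_of_nonneg
    (one_le_mul_of_one_le_of_one_le (one_le_cn g x) (one_le_cn g y)) (by positivity)

theorem cn_edgeLength (g : Background) (hφ : 0 ≤ Real.cos φ) (hx : 0 < x) (hy : 0 < y) :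
    cn g (edgeLength g x y φ) = cosSide g (Real.cos φ) x y := by
  have h := one_le_cosSide g hφ hx hy
  cases g
  · simp [cn, cosSide, kappa]
  · simp only [cosSide, kappa, cn, sn, one_mul] at h ⊢
    exact Real.cosh_arcosh h

theorem sn_edgeLength (g : Background) (hφ : 0 ≤ Real.cos φ) (hx : 0 < x) (hy : 0 < y) :
    sn g (edgeLength g x y φ) = √(sqSide g (Real.cos φ) x y) := by
  have h := one_le_cosSide g hφ hx hy
  have hsq := cosSide_sq g (Real.cos φ) x y
  cases g
  · simp [edgeLength, sn, sqSide, cn, kappa]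
  · rw [show sqSide .hyperbolic (Real.cos φ) x y = cosSide .hyperbolic (Real.cos φ) x y ^ 2 - 1 by
      simp [hsq, kappa]]
    simp only [cosSide, kappa, cn, sn, one_mul] at h ⊢
    exact Real.sinh_arcosh h

theorem innerAngle_edgeLength (g : Background) (hφ : 0 ≤ Real.cos φ) (hχ : 0 ≤ Real.cos χ)
    (hψ : 0 ≤ Real.cos ψ) (hx : 0 < x) (hy : 0 < y) (hz : 0 < z) :
    innerAngle g (edgeLength g x y φ) (edgeLength g x z χ) (edgeLength g y z ψ) =
      faceAngle g (Real.cos ψ) (Real.cos χ) (Real.cos φ) x y z := by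
  have hxy := sn_edgeLength g hφ hx hy
  have hxz := sn_edgeLength g hχ hx hz
  have hyz := sn_edgeLength g hψ hy hz
  have hP := (sqSide_pos g hφ hx hy).le
  have hQ := (sqSide_pos g hχ hx hz).le
  have hR := (sqSide_pos g hψ hy hz).le
  cases g with
  | euclidean =>
    simp only [sn] at hxy hxz hyz
    simp only [innerAngle, faceAngle]
    rw [hxy, hxz, hyz, Real.sq_sqrt hP, Real.sq_sqrt hQ, Real.sq_sqrt hR, mul_assoc,
      ← Real.sqrt_mul hP, ← mul_div_mul_left (angleNum _ _ _ _ x y z) _ (two_ne_zero' ℝ)]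
    simp only [sqSide, angleNum, sn, cn, kappa]
    ring_nf
  | hyperbolic =>
    have hN := kappa_mul_angleNum .hyperbolic (Real.cos ψ) (Real.cos χ) (Real.cos φ) x y z
    rw [← cn_edgeLength _ hφ hx hy, ← cn_edgeLength _ hχ hx hz, ← cn_edgeLength _ hψ hy hz,
      kappa, one_mul] at hN
    simp only [innerAngle, faceAngle]
    rw [hN, Real.sqrt_mul hP, ← hxy, ← hxz]
    rfl

end Side

/-! ### Coordinates in which the flow is `u' = -K` -/

section Coordinate

variable {g : Background}

/-- The coordinate `u` with `du = dr / sn r`; the hyperbolic one is `ln tanh (r / 2)`, written in a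
form that is inverted by the same formula. -/
def coord (g : Background) (r : ℝ) : ℝ :=
  match g with
  | .euclidean => Real.log r
  | .hyperbolic => -Real.arsinh (1 / Real.sinh r)

/-- The radius as a function of the coordinate `u`, inverse to `coord`. -/
def radius (g : Background) (u : ℝ) : ℝ :=
  match g with
  | .euclidean => Real.exp u
  | .hyperbolic => Real.arsinh (1 / Real.sinh (-u))

/-- The values that `coord` takes on positive radii. -/
def coordRange (g : Background) : Set ℝ :=
  match g with
  | .euclidean => univ
  | .hyperbolic => Iio 0

theorem convex_coordRange (g : Background) : Convex ℝ (coordRange g) := by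
  cases g
  exacts [convex_univ, convex_Iio 0]

theorem radius_pos {u : ℝ} (hu : u ∈ coordRange g) : 0 < radius g u := by
  cases g with
  | euclidean => exact Real.exp_pos u
  | hyperbolic =>
    exact Real.arsinh_pos_iff.2 (one_div_pos.2 (Real.sinh_pos_iff.2 (neg_pos.2 hu)))

theorem coord_mem_coordRange (g : Background) {r : ℝ} (hr : 0 < r) :
    coord g r ∈ coordRange g := by
  cases g with
  | euclidean => exact mem_univ _
  | hyperbolic =>
    exact neg_lt_zero.2 (Real.arsinh_pos_iff.2 (one_div_pos.2 (Real.sinh_pos_iff.2 hr)))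

theorem radius_coord (g : Background) {r : ℝ} (hr : 0 < r) : radius g (coord g r) = r := by
  cases g with
  | euclidean => exact Real.exp_log hr
  | hyperbolic => simp [radius, coord]

theorem hasDerivAt_arsinh_inv_sinh {x : ℝ} (hx : 0 < x) :
    HasDerivAt (fun y => Real.arsinh (1 / Real.sinh y)) (-(1 / Real.sinh x)) x := by
  have hs : 0 < Real.sinh x := Real.sinh_pos_iff.2 hx
  have hsqrt : √(1 + (1 / Real.sinh x) ^ 2) = Real.cosh x / Real.sinh x := by
    rw [Real.sqrt_eq_iff_mul_self_eq (by positivity) (by positivity)]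
    have := Real.cosh_sq x
    field_simp
    linarith
  have h : HasDerivAt (fun y => 1 / Real.sinh y) _ x :=
    (hasDerivAt_const x (1 : ℝ)).div (Real.hasDerivAt_sinh x) hs.ne'
  refine h.arsinh.congr_deriv ?_
  rw [hsqrt, smul_eq_mul]
  field_simp
  ring

theorem hasDerivAt_coord (g : Background) {r : ℝ} (hr : 0 < r) :
    HasDerivAt (coord g) (1 / sn g r) r := by
  cases g with
  | euclidean => exact (Real.hasDerivAt_log hr.ne').congr_deriv (one_div r).symm
  | hyperbolic => exact (hasDerivAt_arsinh_inv_sinh hr).neg.congr_deriv (neg_neg _)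

theorem hasDerivAt_radius {u : ℝ} (hu : u ∈ coordRange g) :
    HasDerivAt (radius g) (sn g (radius g u)) u := by
  cases g with
  | euclidean => exact Real.hasDerivAt_exp u
  | hyperbolic =>
    refine ((hasDerivAt_arsinh_inv_sinh (neg_pos.2 hu)).comp u (hasDerivAt_neg u)).congr_deriv ?_
    simp [sn, radius]

theorem strictMonoOn_coord (g : Background) : StrictMonoOn (coord g) (Ioi 0) := by
  refine strictMonoOn_of_hasDerivWithinAt_pos (f' := fun r => 1 / sn g r) (convex_Ioi 0)
    (fun r hr => (hasDerivAt_coord g hr).continuousAt.continuousWithinAt) ?_ ?_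
  all_goals
    intro r hr
    rw [interior_Ioi] at hr
  · exact (hasDerivAt_coord g hr).hasDerivWithinAt
  · exact one_div_pos.2 (sn_pos g hr)

end Coordinate

section FaceAngle

variable {α β γ x y z : ℝ}

theorem faceAngle_mem_Icc (g : Background) (α β γ x y z : ℝ) :
    faceAngle g α β γ x y z ∈ Icc 0 Real.pi :=
  ⟨Real.arccos_nonneg _, Real.arccos_le_pi _⟩

theorem hasDerivAt_radius_segment {g : Background} {u v s : ℝ} (hu : u ∈ coordRange g)
    (hv : v ∈ coordRange g) (hs : s ∈ Icc (0 : ℝ) 1) :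
    HasDerivAt (fun s => radius g (v + s * (u - v)))
      (sn g (radius g (v + s * (u - v))) * (u - v)) s := by
  have h := ((hasDerivAt_id s).mul_const (u - v)).const_add v
  rw [one_mul] at h
  exact (hasDerivAt_radius ((convex_coordRange g).add_smul_sub_mem hv hu hs)).comp s h

theorem abs_faceAngle_radius_sub_le (g : Background) (hα : α ∈ Icc (0 : ℝ) 1)
    (hβ : β ∈ Icc (0 : ℝ) 1) (hγ : γ ∈ Icc (0 : ℝ) 1) {u v w u' v' w' δ : ℝ}
    (hu : u ∈ coordRange g) (hv : v ∈ coordRange g) (hw : w ∈ coordRange g)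
    (hu' : u' ∈ coordRange g) (hv' : v' ∈ coordRange g) (hw' : w' ∈ coordRange g)
    (huu' : |u - u'| ≤ δ) (hvv' : |v - v'| ≤ δ) (hww' : |w - w'| ≤ δ) :
    |faceAngle g α β γ (radius g u) (radius g v) (radius g w) -
      faceAngle g α β γ (radius g u') (radius g v') (radius g w')| ≤ 28 * δ := by
  have hpos {a b : ℝ} (ha : a ∈ coordRange g) (hb : b ∈ coordRange g) {s : ℝ}
      (hs : s ∈ Icc (0 : ℝ) 1) : 0 < radius g (b + s * (a - b)) :=
    radius_pos ((convex_coordRange g).add_smul_sub_mem hb ha hs)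
  have hderiv (s : ℝ) (hs : s ∈ Icc (0 : ℝ) 1) : ∃ d, |d| ≤ 28 * δ ∧
      HasDerivWithinAt (fun s => faceAngle g α β γ (radius g (u' + s * (u - u')))
        (radius g (v' + s * (v - v'))) (radius g (w' + s * (w - w')))) d (Icc 0 1) s :=
    exists_hasDerivWithinAt_faceAngle g hα hβ hγ (hpos hu hu' hs) (hpos hv hv' hs)
      (hpos hw hw' hs) huu' hvv' hww' (hasDerivAt_radius_segment hu hu' hs).hasDerivWithinAt
      (hasDerivAt_radius_segment hv hv' hs).hasDerivWithinAt
      (hasDerivAt_radius_segment hw hw' hs).hasDerivWithinAt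
  choose! d hdle hd using hderiv
  simpa using norm_image_sub_le_of_norm_deriv_le_segment_01' hd
    fun s hs => hdle s (Ico_subset_Icc_self hs)

theorem cn_sq_mul_cosSide_le (g : Background) (hα : α ∈ Icc (0 : ℝ) 1) (hβ : 0 ≤ β)
    (hγ : 0 ≤ γ) (hx : 0 < x) (hy : 0 < y) (hz : 0 < z) :
    cn g x ^ 2 * cosSide g α y z ≤ 2 * (cosSide g γ x y * cosSide g β x z) := by
  have hκ := kappa_nonneg g
  have ha := sn_pos g hx
  have hb := sn_pos g hy
  have hc := sn_pos g hz
  have hA := cn_pos g x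
  have hB := cn_pos g y
  have hC := cn_pos g z
  have hX : cn g x * cn g y ≤ cosSide g γ x y := le_add_of_nonneg_right (by positivity)
  have hY : cn g x * cn g z ≤ cosSide g β x z := le_add_of_nonneg_right (by positivity)
  have hbc : (kappa g * (sn g y * sn g z)) ^ 2 ≤ (cn g y * cn g z) ^ 2 := by
    rw [mul_pow (cn g y), cn_sq, cn_sq]
    nlinarith [mul_nonneg hκ (sq_nonneg (sn g y)), mul_nonneg hκ (sq_nonneg (sn g z))]
  have hZ : cosSide g α y z ≤ 2 * (cn g y * cn g z) := by
    have h1 : kappa g * (sn g y * sn g z) ≤ cn g y * cn g z :=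
      (sq_le_sq₀ (by positivity) (by positivity)).1 hbc
    have h2 : α * (kappa g * (sn g y * sn g z)) ≤ 1 * (kappa g * (sn g y * sn g z)) := by
      gcongr
      exact hα.2
    unfold cosSide
    linarith
  calc cn g x ^ 2 * cosSide g α y z ≤ cn g x ^ 2 * (2 * (cn g y * cn g z)) := by gcongr
    _ = 2 * ((cn g x * cn g y) * (cn g x * cn g z)) := by ring
    _ ≤ 2 * (cosSide g γ x y * cosSide g β x z) := by
      gcongr
      exact (cosSide_pos g hγ hx hy).le

theorem one_sub_le_angleNum_div_hyperbolic (hα : α ∈ Icc (0 : ℝ) 1) (hβ : 0 ≤ β) (hγ : 0 ≤ γ)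
    (hx : 0 < x) (hy : 0 < y) (hz : 0 < z) (hx2 : 2 ≤ Real.cosh x ^ 2) :
    1 - 2 / Real.cosh x ^ 2 ≤ angleNum .hyperbolic α β γ x y z /
      √(sqSide .hyperbolic γ x y * sqSide .hyperbolic β x z) := by
  have hcosh : 0 < Real.cosh x ^ 2 := pow_pos (Real.cosh_pos x) 2
  have hP := sqSide_pos .hyperbolic hγ hx hy
  have hQ := sqSide_pos .hyperbolic hβ hx hz
  have hX := cosSide_pos .hyperbolic hγ hx hy
  have hY := cosSide_pos .hyperbolic hβ hx hz
  have hX2 := cosSide_sq .hyperbolic γ x y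
  have hY2 := cosSide_sq .hyperbolic β x z
  have hN := kappa_mul_angleNum .hyperbolic α β γ x y z
  have hZ : cosSide .hyperbolic α y z ≤
      2 / Real.cosh x ^ 2 * (cosSide .hyperbolic γ x y * cosSide .hyperbolic β x z) := by
    rw [div_mul_eq_mul_div, le_div_iff₀ hcosh, mul_comm]
    exact cn_sq_mul_cosSide_le .hyperbolic hα hβ hγ hx hy hz
  simp only [kappa, one_mul] at hX2 hY2 hN
  have hsqrt : √(sqSide .hyperbolic γ x y * sqSide .hyperbolic β x z) ≤
      cosSide .hyperbolic γ x y * cosSide .hyperbolic β x z := by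
    rw [Real.sqrt_le_left (mul_pos hX hY).le, mul_pow]
    gcongr <;> linarith
  have hle : 0 ≤ 1 - 2 / Real.cosh x ^ 2 := sub_nonneg.2 ((div_le_one hcosh).2 hx2)
  rw [le_div_iff₀ (Real.sqrt_pos.2 (mul_pos hP hQ)), hN]
  calc _ ≤ (1 - 2 / Real.cosh x ^ 2) *
        (cosSide .hyperbolic γ x y * cosSide .hyperbolic β x z) := by gcongr
    _ ≤ _ := by linarith

theorem tendsto_cosh_atTop : Tendsto Real.cosh atTop atTop :=
  tendsto_atTop_mono' atTop (eventually_ge_atTop 0 |>.mono fun _ hx =>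
    (Real.self_le_sinh_iff.2 hx).trans (Real.sinh_lt_cosh _).le) tendsto_id

theorem exists_faceAngle_hyperbolic_le {ε : ℝ} (hε : 0 < ε) :
    ∃ R : ℝ, ∀ α ∈ Icc (0 : ℝ) 1, ∀ β ∈ Icc (0 : ℝ) 1, ∀ γ ∈ Icc (0 : ℝ) 1, ∀ x y z : ℝ,
      0 < x → 0 < y → 0 < z → R ≤ x → faceAngle .hyperbolic α β γ x y z ≤ ε := by
  have hcosh : Tendsto (fun x => Real.cosh x ^ 2) atTop atTop :=
    (tendsto_pow_atTop two_ne_zero).comp tendsto_cosh_atTop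
  have hlim : Tendsto (fun x => Real.arccos (1 - 2 / Real.cosh x ^ 2)) atTop (𝓝 0) := by
    have hdiv : Tendsto (fun x => 2 / Real.cosh x ^ 2) atTop (𝓝 0) :=
      tendsto_const_nhds.div_atTop hcosh
    have h := (Real.continuous_arccos.tendsto _).comp (hdiv.const_sub 1)
    rwa [sub_zero, Real.arccos_one] at h
  obtain ⟨R, hR⟩ := eventually_atTop.1
    ((hlim.eventually_le_const hε).and (hcosh.eventually_ge_atTop 2))
  refine ⟨R, fun α hα β hβ γ hγ x y z hx hy hz hRx => ?_⟩
  exact (Real.arccos_le_arccos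
    (one_sub_le_angleNum_div_hyperbolic hα hβ.1 hγ.1 hx hy hz (hR x hRx).2)).trans (hR x hRx).1

end FaceAngle

/-! ### The curvature -/

section Curvature

variable {V : Type*} {T : AbstractSimplicialComplex V} {Φ : Sym2 V → ℝ} {i : V} {M : ℕ}

theorem abs_finsum_mem_le {ι : Type*} {s : Set ι} (hs : s.encard ≤ M) {f : ι → ℝ} {c : ℝ}
    (hc : 0 ≤ c) (hf : ∀ a ∈ s, |f a| ≤ c) : |∑ᶠ a ∈ s, f a| ≤ M * c := by
  lift s to Finset ι using finite_of_encard_le_coe hs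
  rw [encard_coe_eq_coe_finsetCard, Nat.cast_le] at hs
  rw [finsum_mem_coe_finset]
  calc |∑ a ∈ s, f a| ≤ ∑ a ∈ s, |f a| := Finset.abs_sum_le_sum_abs f s
    _ ≤ s.card * c := by simpa using Finset.sum_le_card_nsmul s _ c hf
    _ ≤ M * c := by gcongr

theorem skeleton_adj_of_mem {s : Finset V} (hs : s ∈ T.faces) {j k : V} (hj : j ∈ s) (hk : k ∈ s)
    (hjk : j ≠ k) : (skeleton T).Adj j k := by
  classical
  refine ⟨hjk, (T.isRelLowerSet_faces hs).2 ?_ (Finset.insert_nonempty _ _)⟩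
  exact Finset.insert_subset hj (Finset.singleton_subset_iff.2 hk)

theorem exists_adj_of_mem_oppositeEdges {e : Sym2 V} (he : e ∈ oppositeEdges T i) :
    ∃ j k, e = s(j, k) ∧ (skeleton T).Adj i j ∧ (skeleton T).Adj i k ∧ (skeleton T).Adj j k := by
  classical
  obtain ⟨j, k, rfl, hij, hik, hjk, hs⟩ := he
  exact ⟨j, k, rfl, skeleton_adj_of_mem hs (by simp) (by simp) hij,
    skeleton_adj_of_mem hs (by simp) (by simp) hik, skeleton_adj_of_mem hs (by simp) (by simp) hjk⟩

theorem encard_oppositeEdges_le (T : AbstractSimplicialComplex V) (i : V) :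
    (oppositeEdges T i).encard ≤ degree T i ^ 2 := by
  have hsub : oppositeEdges T i ⊆ (fun p : V × V => s(p.1, p.2)) ''
      ((skeleton T).neighborSet i ×ˢ (skeleton T).neighborSet i) := fun e he => by
    obtain ⟨j, k, rfl, hij, hik, -⟩ := exists_adj_of_mem_oppositeEdges he
    exact ⟨(j, k), ⟨hij, hik⟩, rfl⟩
  calc (oppositeEdges T i).encard ≤ _ := encard_le_encard hsub
    _ ≤ _ := encard_image_le _ _
    _ = degree T i ^ 2 := by rw [encard_prod, sq, degree]

theorem exists_theta_eq (hΦ : ∀ e ∈ (skeleton T).edgeSet, Φ e ∈ Icc 0 (Real.pi / 2))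
    {e : Sym2 V} (he : e ∈ oppositeEdges T i) :
    ∃ j k, ∃ α ∈ Icc (0 : ℝ) 1, ∃ β ∈ Icc (0 : ℝ) 1, ∃ γ ∈ Icc (0 : ℝ) 1,
      ∀ g r, (∀ l, 0 < r l) → theta g Φ r i e = faceAngle g α β γ (r i) (r j) (r k) := by
  obtain ⟨j, k, rfl, hij, hik, hjk⟩ := exists_adj_of_mem_oppositeEdges he
  have hcos {x y : V} (h : (skeleton T).Adj x y) : Real.cos (Φ s(x, y)) ∈ Icc (0 : ℝ) 1 := by
    obtain ⟨h0, h1⟩ := hΦ s(x, y) h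
    exact ⟨Real.cos_nonneg_of_neg_pi_div_two_le_of_le (by linarith [Real.pi_pos]) h1,
      Real.cos_le_one _⟩
  exact ⟨j, k, _, hcos hjk, _, hcos hik, _, hcos hij, fun g r hr =>
    innerAngle_edgeLength g (hcos hij).1 (hcos hik).1 (hcos hjk).1 (hr i) (hr j) (hr k)⟩

/-- The right-hand side `-K` of the flow in the coordinates `u i = coord g (r i)`. -/
def coordField (g : Background) (T : AbstractSimplicialComplex V) (Φ : Sym2 V → ℝ) (u : V → ℝ)
    (i : V) : ℝ :=
  -curvature g T Φ (fun j => radius g (u j)) i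

theorem abs_coordField_le (g : Background)
    (hΦ : ∀ e ∈ (skeleton T).edgeSet, Φ e ∈ Icc 0 (Real.pi / 2))
    (hM : (oppositeEdges T i).encard ≤ M) {u : V → ℝ} (hu : ∀ j, u j ∈ coordRange g) :
    |coordField g T Φ u i| ≤ 2 * Real.pi + M * Real.pi := by
  have hsum := abs_finsum_mem_le hM Real.pi_pos.le (f := theta g Φ (fun j => radius g (u j)) i)
    fun e he => by
      obtain ⟨j, k, α, -, β, -, γ, -, h⟩ := exists_theta_eq hΦ he
      rw [h g _ fun l => radius_pos (hu l), abs_of_nonneg (faceAngle_mem_Icc _ _ _ _ _ _ _).1]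
      exact (faceAngle_mem_Icc _ _ _ _ _ _ _).2
  rw [coordField, abs_neg, curvature]
  refine (abs_sub _ _).trans (add_le_add (abs_of_pos Real.two_pi_pos).le hsum)

theorem abs_coordField_sub_le (g : Background)
    (hΦ : ∀ e ∈ (skeleton T).edgeSet, Φ e ∈ Icc 0 (Real.pi / 2))
    (hM : (oppositeEdges T i).encard ≤ M) {u v : V → ℝ} (hu : ∀ j, u j ∈ coordRange g)
    (hv : ∀ j, v j ∈ coordRange g) {δ : ℝ} (huv : ∀ j, |u j - v j| ≤ δ) :
    |coordField g T Φ u i - coordField g T Φ v i| ≤ 28 * M * δ := by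
  have hδ : 0 ≤ δ := (abs_nonneg _).trans (huv i)
  have hsum := abs_finsum_mem_le hM (c := 28 * δ) (by positivity)
    (f := fun e => theta g Φ (fun j => radius g (u j)) i e -
      theta g Φ (fun j => radius g (v j)) i e) fun e he => by
      obtain ⟨j, k, α, hα, β, hβ, γ, hγ, h⟩ := exists_theta_eq hΦ he
      rw [h g _ fun l => radius_pos (hu l), h g _ fun l => radius_pos (hv l)]
      exact abs_faceAngle_radius_sub_le g hα hβ hγ (hu i) (hu j) (hu k) (hv i) (hv j) (hv k)
        (huv i) (huv j) (huv k)
  rw [finsum_mem_sub_distrib _ _ (finite_of_encard_le_coe hM)] at hsum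
  simp only [coordField, curvature]
  rw [neg_sub_neg, sub_sub_sub_cancel_left]
  linarith

theorem isUniformField_coordField (g : Background)
    (hΦ : ∀ e ∈ (skeleton T).edgeSet, Φ e ∈ Icc 0 (Real.pi / 2))
    (hM : ∀ i, (oppositeEdges T i).encard ≤ M) :
    IsUniformField (coordField g T Φ) {u | ∀ i, u i ∈ coordRange g}
      (2 * Real.pi + M * Real.pi) (28 * M) where
  bound_nonneg := by positivity
  lipschitz_nonneg := by positivity
  bound _ hu i := abs_coordField_le g hΦ (hM i) hu
  lipschitz _ hu _ hv _ huv i := abs_coordField_sub_le g hΦ (hM i) hu hv huv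

theorem exists_curvature_hyperbolic_pos
    (hΦ : ∀ e ∈ (skeleton T).edgeSet, Φ e ∈ Icc 0 (Real.pi / 2))
    (hM : ∀ i, (oppositeEdges T i).encard ≤ M) :
    ∃ R : ℝ, ∀ r : V → ℝ, (∀ j, 0 < r j) → ∀ i, R ≤ r i →
      0 < curvature .hyperbolic T Φ r i := by
  have hπ := Real.pi_pos
  obtain ⟨R, hR⟩ := exists_faceAngle_hyperbolic_le (ε := Real.pi / (M + 1)) (by positivity)
  refine ⟨R, fun r hr i hi => ?_⟩
  have hsum := abs_finsum_mem_le (hM i) (c := Real.pi / (M + 1)) (by positivity)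
    (f := theta .hyperbolic Φ r i) fun e he => by
      obtain ⟨j, k, α, hα, β, hβ, γ, hγ, h⟩ := exists_theta_eq hΦ he
      rw [h _ r hr, abs_of_nonneg (faceAngle_mem_Icc _ _ _ _ _ _ _).1]
      exact hR α hα β hβ γ hγ _ _ _ (hr i) (hr j) (hr k) hi
  have hπM : M * (Real.pi / (M + 1)) ≤ Real.pi := by
    rw [mul_div_assoc', div_le_iff₀ (by positivity)]
    linarith
  rw [curvature]
  linarith [(abs_le.1 hsum).2]

theorem contDiffOn_curvature (g : Background)
    (hΦ : ∀ e ∈ (skeleton T).edgeSet, Φ e ∈ Icc 0 (Real.pi / 2))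
    (hfin : (oppositeEdges T i).Finite) {r : ℝ → V → ℝ} {S : Set ℝ} {n : WithTop ℕ∞}
    (hpos : ∀ t ∈ S, ∀ j, 0 < r t j) (hr : ∀ j, ContDiffOn ℝ n (fun t => r t j) S) :
    ContDiffOn ℝ n (fun t => curvature g T Φ (r t) i) S := by
  simp only [curvature, finsum_mem_eq_finite_toFinset_sum _ hfin]
  refine contDiffOn_const.sub (ContDiffOn.sum fun e he => ?_)
  obtain ⟨j, k, α, hα, β, hβ, γ, hγ, h⟩ := exists_theta_eq hΦ (hfin.mem_toFinset.1 he)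
  exact (contDiffOn_faceAngle g hα hβ hγ (fun t ht => hpos t ht i) (fun t ht => hpos t ht j)
    (fun t ht => hpos t ht k) (hr i) (hr j) (hr k)).congr fun t ht => h g _ (hpos t ht)

end Curvature

/-! ### Solutions of the flow -/

section Solution

variable {V : Type*} {T : AbstractSimplicialComplex V} {Φ : Sym2 V → ℝ} {M : ℕ} {g : Background}
  {r₀ : V → ℝ}

theorem flowField_eq (g : Background) (T : AbstractSimplicialComplex V) (Φ : Sym2 V → ℝ)
    (r : V → ℝ) (i : V) : flowField g T Φ r i = sn g (r i) * -curvature g T Φ r i := by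
  cases g <;> exact mul_comm _ _

theorem IsSolution.contDiffOn {r : ℝ → V → ℝ} (h : IsSolution g T Φ r₀ r)
    (hΦ : ∀ e ∈ (skeleton T).edgeSet, Φ e ∈ Icc 0 (Real.pi / 2))
    (hfin : ∀ i, (oppositeEdges T i).Finite) (i : V) :
    ContDiffOn ℝ ∞ (fun t => r t i) (Ici 0) := by
  rw [contDiffOn_infty]
  intro n
  induction n generalizing i with
  | zero => exact contDiffOn_zero.2 fun t ht => (h.flow t ht i).continuousWithinAt
  | succ n ih =>
    push_cast
    rw [contDiffOn_succ_iff_derivWithin (uniqueDiffOn_Ici 0)]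
    refine ⟨fun t ht => (h.flow t ht i).differentiableWithinAt, by simp, ?_⟩
    have hfield := ((contDiff_sn g).comp_contDiffOn (ih i)).mul
      (contDiffOn_curvature g hΦ (hfin i) h.pos ih).neg
    refine hfield.congr fun t ht => ?_
    rw [(h.flow t ht i).derivWithin (uniqueDiffOn_Ici 0 t ht), flowField_eq]
    rfl

theorem IsSolution.isFlowLineOn_coord {r : ℝ → V → ℝ} (h : IsSolution g T Φ r₀ r) :
    IsFlowLineOn (coordField g T Φ) (fun t i => coord g (r t i)) (Ici 0) := by
  intro t ht i
  have hpos := h.pos t ht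
  refine ((hasDerivAt_coord g (hpos i)).comp_hasDerivWithinAt t (h.flow t ht i)).congr_deriv ?_
  simp only [coordField, radius_coord g (hpos _)]
  rw [flowField_eq, ← mul_assoc, one_div_mul_cancel (sn_pos g (hpos i)).ne', one_mul]

theorem IsSolution.eqOn {r r' : ℝ → V → ℝ} (h : IsSolution g T Φ r₀ r)
    (h' : IsSolution g T Φ r₀ r') (hΦ : ∀ e ∈ (skeleton T).edgeSet, Φ e ∈ Icc 0 (Real.pi / 2))
    (hM : ∀ i, (oppositeEdges T i).encard ≤ M) : EqOn r r' (Ici 0) := by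
  intro t ht
  have hu := (isUniformField_coordField g hΦ hM).eqOn_Icc (T := t)
    (fun s hs i => coord_mem_coordRange g (h.pos s hs.1 i))
    (fun s hs i => coord_mem_coordRange g (h'.pos s hs.1 i))
    (h.isFlowLineOn_coord.mono Icc_subset_Ici_self)
    (h'.isFlowLineOn_coord.mono Icc_subset_Ici_self)
    (by simp only [h.initial, h'.initial]) (right_mem_Icc.2 ht)
  funext i
  rw [← radius_coord g (h.pos t ht i), ← radius_coord g (h'.pos t ht i)]
  exact congrArg (radius g) (congrFun hu i)

theorem exists_isFlowLineOn_coordField (g : Background)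
    (hΦ : ∀ e ∈ (skeleton T).edgeSet, Φ e ∈ Icc 0 (Real.pi / 2))
    (hM : ∀ i, (oppositeEdges T i).encard ≤ M) (hr₀ : ∀ i, 0 < r₀ i) :
    ∃ u : ℝ → V → ℝ, (u 0 = fun i => coord g (r₀ i)) ∧
      (∀ t ∈ Ici 0, ∀ i, u t i ∈ coordRange g) ∧
      IsFlowLineOn (coordField g T Φ) u (Ici 0) := by
  have hfield := isUniformField_coordField g hΦ hM
  cases g with
  | euclidean =>
    obtain ⟨u, hu0, hu⟩ := (hfield.mono fun u _ i => mem_univ (u i)).exists_isFlowLineOn_Ici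
      fun i => coord .euclidean (r₀ i)
    exact ⟨u, hu0, fun t _ i => mem_univ (u t i), hu⟩
  | hyperbolic =>
    obtain ⟨R, hR⟩ := exists_curvature_hyperbolic_pos hΦ hM
    have hmax (i : V) : 0 < max (r₀ i) R := lt_max_of_lt_left (hr₀ i)
    let m : V → ℝ := fun i => coord .hyperbolic (max (r₀ i) R)
    have hrange {u : V → ℝ} (hu : ∀ i, u i ≤ m i) (i : V) : u i ∈ coordRange .hyperbolic :=
      (hu i).trans_lt (coord_mem_coordRange .hyperbolic (hmax i))
    have hneg (u : V → ℝ) (hu : ∀ i, u i ≤ m i) (i : V) (hi : u i = m i) :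
        coordField .hyperbolic T Φ u i < 0 := by
      refine neg_lt_zero.2 (hR _ (fun j => radius_pos (hrange hu j)) i ?_)
      rw [hi, radius_coord .hyperbolic (hmax i)]
      exact le_max_right _ _
    obtain ⟨u, hu0, hum, hu⟩ := (hfield.mono fun _ => hrange).exists_isFlowLineOn_Ici_of_neg hneg
      fun i => (strictMonoOn_coord .hyperbolic).monotoneOn (hr₀ i) (hmax i) (le_max_left _ _)
    exact ⟨u, hu0, fun t ht => hrange (hum t ht), hu⟩

theorem exists_isSolution (g : Background)
    (hΦ : ∀ e ∈ (skeleton T).edgeSet, Φ e ∈ Icc 0 (Real.pi / 2))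
    (hM : ∀ i, (oppositeEdges T i).encard ≤ M) (hr₀ : ∀ i, 0 < r₀ i) :
    ∃ r, IsSolution g T Φ r₀ r := by
  obtain ⟨u, hu0, hrange, hu⟩ := exists_isFlowLineOn_coordField g hΦ hM hr₀
  refine ⟨fun t i => radius g (u t i), fun t ht i => radius_pos (hrange t ht i), ?_,
    fun t ht i => ?_⟩
  · simp only [hu0, radius_coord g (hr₀ _)]
  · rw [flowField_eq]
    exact (hasDerivAt_radius (hrange t ht i)).comp_hasDerivWithinAt t (hu t ht i)

end Solution

end CRF

end

theorem theorem1p2_general {V : Type*} (T : AbstractSimplicialComplex V)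
    (hdeg : ∃ N : ℕ, ∀ i, CRF.degree T i ≤ N)
    (Φ : Sym2 V → ℝ)
    (hΦ : ∀ e ∈ (CRF.skeleton T).edgeSet, Φ e ∈ Set.Icc 0 (Real.pi / 2))
    (g : CRF.Background) (r₀ : V → ℝ) (hr₀ : ∀ i, 0 < r₀ i) :
    ∃ r : ℝ → V → ℝ, CRF.IsSolution g T Φ r₀ r ∧
      (∀ i, ContDiffOn ℝ ∞ (fun t => r t i) (Set.Ici 0)) ∧
      ∀ r' : ℝ → V → ℝ, CRF.IsSolution g T Φ r₀ r' → ∀ t, 0 ≤ t → r' t = r t := by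
  obtain ⟨N, hN⟩ := hdeg
  have hM (i : V) : (CRF.oppositeEdges T i).encard ≤ (N ^ 2 : ℕ) := by
    push_cast
    exact (CRF.encard_oppositeEdges_le T i).trans (pow_le_pow_left' (hN i) 2)
  have hfin (i : V) : (CRF.oppositeEdges T i).Finite := finite_of_encard_le_coe (hM i)
  obtain ⟨r, hr⟩ := CRF.exists_isSolution g hΦ hM hr₀
  exact ⟨r, hr, hr.contDiffOn hΦ hfin, fun r' hr' t ht => hr'.eqOn hr hΦ hM ht⟩

theorem theorem1p2 {V : Type*} [Infinite V] (T : AbstractSimplicialComplex V)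
    (hT : CRF.IsDiskTriangulation T)
    (hdeg : ∃ N : ℕ, ∀ i, CRF.degree T i ≤ N)
    (Φ : Sym2 V → ℝ)
    (hΦ : ∀ e ∈ (CRF.skeleton T).edgeSet, Φ e ∈ Set.Icc 0 (Real.pi / 2))
    (g : CRF.Background) (r₀ : V → ℝ) (hr₀ : ∀ i, 0 < r₀ i) :
    ∃ r : ℝ → V → ℝ, CRF.IsSolution g T Φ r₀ r ∧
      (∀ i, ContDiffOn ℝ ∞ (fun t => r t i) (Set.Ici 0)) ∧
      ∀ r' : ℝ → V → ℝ, CRF.IsSolution g T Φ r₀ r' → ∀ t, 0 ≤ t → r' t = r t :=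
  theorem1p2_general T hdeg Φ hΦ g r₀ hr₀
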